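/- Let $S:[0,\infty)\to\mathbb{R}$ be locally integrable on $[0,\infty)$ and let $a\in\mathbb{R}$. Then $$\lim_{x\to\infty} e^{-x}S(x)=a \qquad (\text{that is, } S(x)\sim a e^{x},\text{ read as } S(x)=o(e^x) \text{ if } a=0)$$ holds if and only if the following three conditions all hold: (i) $S$ is log-linearly slowly decreasing: for each $\varepsilon>0$ there exist $\delta>0$ and $x_0$ such that $\dfrac{S(x+h)-S(x)}{e^{x}}\ge -\varepsilon$ for all $0\le h\le\delta$ and $x\ge x_0$; (ii) the Laplace transform $\mathcal{L}\{S;s\}=\int_0^\infty e^{-sx}S(x)\,dx=\lim_{T\to\infty}\int_0^T e^{-sx}S(x)\,dx$ converges (possibly conditionally) for every $s\in\mathbb{C}$ with $\operatorname{Re}s>1$; (iii) the function $G(s)=\mathcal{L}\{S;s\}-\dfrac{a}{s-1}$, analytic on $\operatorname{Re}s>1$, admits local pseudofunction boundary behavior on the whole line $\operatorname{Re}s=1$: there is a distribution $g\in\mathcal{D}'(\mathbb{R})$ which is a local pseudofunction on $\mathbb{R}$ and satisfies $$\lim_{\sigma\to1^+}\int_{-\infty}^{\infty}G(\sigma+it)\varphi(t)\,dt=\langle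 g,\varphi\rangle\qquad\text{for every }\varphi\in\mathcal{D}(\mathbb{R}).$$ Here $\mathcal{D}(\mathbb{R})$ is the space of complex-valued compactly supported smooth functions on $\mathbb{R}$. A tempered distribution $f\in\mathcal{S}'(\mathbb{R})$ is a pseudofunction if its Fourier transform $\hat f$ belongs to $L^\infty(\mathbb{R})$ and $\lim_{|x|\to\infty}\hat f(x)=0$. A distribution $g\in\mathcal{D}'(\mathbb{R})$ is a local pseudofunction on $\mathbb{R}$ if every $t_0\in\mathbb{R}$ has an open neighborhood on which $g$ coincides with a pseudofunction. -/

import Mathlib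

open Set Filter Topology MeasureTheory
open scoped SchwartzMap Distributions FourierTransform

noncomputable section

namespace WienerIkehara

/-- `S` is log-linearly slowly decreasing. -/
def LogLinearlySlowlyDecreasing (S : ℝ → ℝ) : Prop :=
  ∀ ε : ℝ, 0 < ε → ∃ δ : ℝ, 0 < δ ∧ ∃ x₀ : ℝ, ∀ x : ℝ, x₀ ≤ x → ∀ h : ℝ, 0 ≤ h → h ≤ δ →
    -ε ≤ (S (x + h) - S x) / Real.exp x

/-- The truncated Laplace integral `∫_0^T e^{-sx} S(x) dx`. -/
def laplacePartial (S : ℝ → ℝ) (s : ℂ) (T : ℝ) : ℂ :=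
  ∫ x in (0 : ℝ)..T, Complex.exp (-s * (x : ℂ)) * (S x : ℂ)

/-- The improper integral `∫_0^∞ e^{-sx} S(x) dx` converges (possibly only conditionally). -/
def LaplaceConverges (S : ℝ → ℝ) (s : ℂ) : Prop :=
  ∃ L : ℂ, Tendsto (laplacePartial S s) atTop (𝓝 L)

/-- The Laplace transform `∫_0^∞ e^{-sx} S(x) dx`, as an improper integral
(meaningful where `LaplaceConverges S s`). -/
def laplace (S : ℝ → ℝ) (s : ℂ) : ℂ :=
  limUnder atTop (laplacePartial S s)

/-- A tempered distribution on the line is a (global) pseudofunction if its Fourier transform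
is (given by) an essentially bounded function that tends to `0` at `±∞`. Mathlib's Fourier
transform uses the kernel `e^{-2πitx}`; with the kernel `e^{-itx}` the class is the same, since
the two transforms differ by a dilation. The function `u` is a representative of a class in
`L^∞`, so the limit may be required everywhere. -/
def IsPseudofunction (f : 𝓢'(ℝ, ℂ)) : Prop :=
  ∃ u : ℝ → ℂ, MemLp u ⊤ volume ∧ Tendsto u (cocompact ℝ) (𝓝 0) ∧
    ∀ φ : 𝓢(ℝ, ℂ), (𝓕 f) φ = ∫ x : ℝ, φ x * u x

/-- A compactly supported smooth test function, seen as a Schwartz function. -/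
def testToSchwartz {U : TopologicalSpace.Opens ℝ} (φ : 𝓓(U, ℂ)) : 𝓢(ℝ, ℂ) :=
  HasCompactSupport.toSchwartzMap φ.hasCompactSupport φ.contDiff

/-- The distribution `g ∈ 𝓓'(U)` (a continuous linear functional on the complex-valued test
functions) is a pseudofunction at the point `t₀`: on some open neighbourhood of `t₀` it coincides
with a global pseudofunction. -/
def IsPseudofunctionAt {U : TopologicalSpace.Opens ℝ} (g : 𝓓(U, ℂ) →L[ℂ] ℂ) (t₀ : ℝ) : Prop :=
  ∃ V : Set ℝ, IsOpen V ∧ t₀ ∈ V ∧ V ⊆ (U : Set ℝ) ∧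
    ∃ f : 𝓢'(ℝ, ℂ), IsPseudofunction f ∧
      ∀ φ : 𝓓(U, ℂ), tsupport (φ : ℝ → ℂ) ⊆ V → g φ = f (testToSchwartz φ)

/-- `g ∈ PF_loc(U)`. -/
def IsLocalPseudofunction {U : TopologicalSpace.Opens ℝ} (g : 𝓓(U, ℂ) →L[ℂ] ℂ) : Prop :=
  ∀ t₀ ∈ U, IsPseudofunctionAt g t₀

/-- The function `G`, analytic on `Re s > α`, has local pseudofunction boundary behaviour on
`α + iU`: its distributional boundary value there exists and is a local pseudofunction on `U`. -/
def HasLocalPseudofunctionBoundary (G : ℂ → ℂ) (α : ℝ) (U : TopologicalSpace.Opens ℝ) : Prop :=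
  DifferentiableOn ℂ G {s : ℂ | α < s.re} ∧
    ∃ g : 𝓓(U, ℂ) →L[ℂ] ℂ, IsLocalPseudofunction g ∧
      ∀ φ : 𝓓(U, ℂ),
        Tendsto (fun σ : ℝ => ∫ t : ℝ, G ((σ : ℂ) + Complex.I * (t : ℂ)) * φ t)
          (𝓝[>] α) (𝓝 (g φ))

end WienerIkehara

end

/-!
The equivalence rests on the remainder `R x = S x / e^x - a` on `x > 0`, extended by zero. Where the
Laplace integral converges absolutely, `laplace S s - a / (s - 1)` is the Laplace transform of `R`
at `s - 1`, and pairing its values on the line `Re s = σ` with a test function `φ` gives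
`∫ e^{-(σ-1)x} R(x) φ̂(x) dx` (`integral_laplace_sub_mul`).

If `R → 0`, dominated convergence as `σ → 1` shows that the boundary value is `φ ↦ ∫ R φ̂`, the
Fourier transform of `R`. Here `R` is the sum of an integrable function with bounded support, whose
transform is smooth, and a bounded function vanishing at infinity, whose transform is a
pseudofunction; so the boundary value is a local pseudofunction (`exists_localPseudofunction`).

Conversely, slow decrease bounds `R` from below, so the Laplace integral converges absolutely. For
test functions with `φ̂ ≥ 0`, the damping factor can then be removed by Fatou's lemma and dominated
convergence, and `∫ R(x) φ̂(x - h) dx` equals the boundary value at `e^{iht} φ(t)`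
(`averagesVanish_remainder`). A local pseudofunction has the Riemann–Lebesgue property, so this
tends to `0` as `h → ∞` (`IsLocalPseudofunction.tendsto_modulate`). With `φ = η ⋆ η` for an even
bump `η`, and with its dilates, the averages of `R` against an approximate identity tend to zero.
The lower bound and slow decrease first make `R` bounded, then force `R → 0`
(`IsAveragingKernel.tendsto_zero_of_averagesVanish`).
-/

namespace WienerIkehara

/-! ### Fourier transforms of test functions -/

/-- The Fourier transform with the kernel `e^{-ixt}` (no `2π` in the exponent). -/
noncomputable def angularFourier (φ : ℝ → ℂ) (x : ℝ) : ℂ :=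
  ∫ t : ℝ, Complex.exp (-(Complex.I * x * t)) * φ t

lemma angularFourier_eq_fourier (φ : ℝ → ℂ) (x : ℝ) :
    angularFourier φ x = 𝓕 φ (x / (2 * Real.pi)) := by
  rw [Real.fourier_real_eq_integral_exp_smul, angularFourier]
  congr 1 with t
  rw [smul_eq_mul]
  congr 2
  push_cast
  field_simp

/-- The product of a smooth function and a test function, as a test function. -/
noncomputable def smoothMul {U : TopologicalSpace.Opens ℝ} (m : ℝ → ℂ)
    (hm : ContDiff ℝ (⊤ : ℕ∞) m) (φ : 𝓓(U, ℂ)) : 𝓓(U, ℂ) where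
  toFun t := m t * φ t
  contDiff' := hm.mul φ.contDiff
  hasCompactSupport' := φ.hasCompactSupport.mul_left
  tsupport_subset' := (tsupport_mul_subset_right).trans φ.tsupport_subset

@[simp] lemma smoothMul_apply {U : TopologicalSpace.Opens ℝ} (m : ℝ → ℂ)
    (hm : ContDiff ℝ (⊤ : ℕ∞) m) (φ : 𝓓(U, ℂ)) (t : ℝ) : smoothMul m hm φ t = m t * φ t := rfl

lemma testFunction_sum_apply {U : TopologicalSpace.Opens ℝ} {ι : Type*} (s : Finset ι)
    (φ : ι → 𝓓(U, ℂ)) (t : ℝ) : (∑ i ∈ s, φ i) t = ∑ i ∈ s, φ i t := by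
  have := map_sum (FunLike.coeAddMonoidHom 𝓓(U, ℂ) ℝ ℂ) φ s
  exact (congrFun this t).trans (Finset.sum_apply t s _)

lemma contDiff_character (h : ℝ) :
    ContDiff ℝ (⊤ : ℕ∞) (fun t : ℝ => Complex.exp (Complex.I * h * t)) := by
  have : ContDiff ℝ (⊤ : ℕ∞) (fun t : ℝ => (t : ℂ)) := Complex.ofRealCLM.contDiff
  exact (contDiff_const.mul this).cexp

/-- The test function `t ↦ e^{iht} φ(t)`, whose Fourier transform is that of `φ` translated
by `h`. -/
noncomputable def modulate {U : TopologicalSpace.Opens ℝ} (h : ℝ) (φ : 𝓓(U, ℂ)) : 𝓓(U, ℂ) :=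
  smoothMul _ (contDiff_character h) φ

lemma modulate_apply {U : TopologicalSpace.Opens ℝ} (h : ℝ) (φ : 𝓓(U, ℂ)) (t : ℝ) :
    modulate h φ t = Complex.exp (Complex.I * h * t) * φ t := rfl

lemma angularFourier_modulate {U : TopologicalSpace.Opens ℝ} (h : ℝ) (φ : 𝓓(U, ℂ)) (x : ℝ) :
    angularFourier (modulate h φ) x = angularFourier φ (x - h) := by
  unfold angularFourier
  congr 1 with t
  rw [modulate_apply, ← mul_assoc, ← Complex.exp_add]
  congr 2
  push_cast
  ring

lemma angularFourier_eq_schwartz {U : TopologicalSpace.Opens ℝ} (φ : 𝓓(U, ℂ)) (x : ℝ) :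
    angularFourier φ x = (𝓕 (testToSchwartz φ)) (x / (2 * Real.pi)) :=
  angularFourier_eq_fourier φ x

lemma continuous_angularFourier {U : TopologicalSpace.Opens ℝ} (φ : 𝓓(U, ℂ)) :
    Continuous (angularFourier φ) := by
  simp_rw [funext (angularFourier_eq_schwartz φ)]
  exact (SchwartzMap.continuous _).comp (continuous_id.div_const _)

lemma integrable_angularFourier {U : TopologicalSpace.Opens ℝ} (φ : 𝓓(U, ℂ)) :
    Integrable (angularFourier φ) := by
  simp_rw [funext (angularFourier_eq_schwartz φ)]
  exact (SchwartzMap.integrable (𝓕 (testToSchwartz φ))).comp_div (by positivity)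

lemma tendsto_angularFourier {U : TopologicalSpace.Opens ℝ} (φ : 𝓓(U, ℂ)) :
    Tendsto (angularFourier φ) (cocompact ℝ) (𝓝 0) := by
  simp_rw [funext (angularFourier_eq_fourier φ)]
  refine (Real.zero_at_infty_fourier (φ : ℝ → ℂ)).comp ?_
  have hc : (2 * Real.pi)⁻¹ ≠ 0 := by positivity
  simpa [div_eq_mul_inv] using! (Homeomorph.mulRight₀ _ hc).isClosedEmbedding.tendsto_cocompact

lemma exists_bound_angularFourier {U : TopologicalSpace.Opens ℝ} (φ : 𝓓(U, ℂ)) :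
    ∃ B : ℝ, ∀ x, ‖angularFourier φ x‖ ≤ B := by
  refine ⟨∫ t, ‖φ t‖, fun x => (norm_integral_le_integral_norm _).trans_eq ?_⟩
  congr 1 with t
  rw [norm_mul, Complex.norm_exp]
  simp

/-! ### Decay of local pseudofunctions under modulation -/

/-- A pseudofunction is evaluated on the Fourier side, where modulation becomes translation; since
its Fourier transform is bounded and vanishes at infinity, dominated convergence applies. -/
lemma tendsto_pseudofunction_modulate {f : 𝓢'(ℝ, ℂ)} (hf : IsPseudofunction f)
    {U : TopologicalSpace.Opens ℝ} (φ : 𝓓(U, ℂ)) :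
    Tendsto (fun h : ℝ => f (testToSchwartz (modulate h φ))) atTop (𝓝 0) := by
  obtain ⟨u, hu, hu0, hfu⟩ := hf
  have hval : ∀ ψ : 𝓢(ℝ, ℂ), f ψ = ∫ y, (𝓕⁻ ψ) y * u y := by
    intro ψ
    rw [← hfu (𝓕⁻ ψ), TemperedDistribution.fourier_apply, FourierTransform.fourier_fourierInv_eq]
  set Φ : 𝓢(ℝ, ℂ) := 𝓕⁻ (testToSchwartz φ) with hΦ
  have hmod : ∀ h y : ℝ, (𝓕⁻ (testToSchwartz (modulate h φ))) y = Φ (y + h / (2 * Real.pi)) := by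
    intro h y
    rw [hΦ, SchwartzMap.fourierInv_coe, SchwartzMap.fourierInv_coe, Real.fourierInv_eq',
      Real.fourierInv_eq']
    congr 1 with t
    simp only [smul_eq_mul]
    change _ * (Complex.exp (Complex.I * h * t) * φ t) = _ * φ t
    rw [← mul_assoc, ← Complex.exp_add]
    congr 2
    simp only [RCLike.inner_apply, conj_trivial]
    push_cast
    field_simp
  have hshift : ∀ h : ℝ, f (testToSchwartz (modulate h φ)) =
      ∫ y, Φ y * u (y - h / (2 * Real.pi)) := by
    intro h
    rw [hval, ← integral_sub_right_eq_self _ (h / (2 * Real.pi))]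
    simp [hmod]
  simp_rw [hshift]
  have hM : ∀ᵐ y, ‖u y‖ ≤ (eLpNorm u ⊤ volume).toReal := by
    filter_upwards [ae_le_eLpNormEssSup (f := u) (μ := volume)] with y hy
    rw [← toReal_enorm]
    exact ENNReal.toReal_mono hu.2.ne (by simpa using hy)
  have key := tendsto_integral_filter_of_dominated_convergence (μ := volume) (l := atTop)
    (F := fun (h : ℝ) y => Φ y * u (y - h / (2 * Real.pi))) (f := fun _ => (0 : ℂ))
    (fun y => ‖Φ y‖ * (eLpNorm u ⊤ volume).toReal) ?_ ?_ (Φ.integrable.norm.mul_const _) ?_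
  · simpa using key
  · refine .of_forall fun h => Φ.continuous.aestronglyMeasurable.mul ?_
    exact hu.1.comp_quasiMeasurePreserving
      (measurePreserving_sub_right volume (h / (2 * Real.pi))).quasiMeasurePreserving
  · refine .of_forall fun h => ?_
    filter_upwards [(measurePreserving_sub_right volume
      (h / (2 * Real.pi))).quasiMeasurePreserving.ae hM] with y hy
    rw [norm_mul]
    exact mul_le_mul_of_nonneg_left hy (norm_nonneg _)
  · refine .of_forall fun y => ?_
    have h1 : Tendsto (fun h : ℝ => y - h / (2 * Real.pi)) atTop atBot :=
      tendsto_atBot_add_const_left _ y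
        (tendsto_neg_atTop_atBot.comp (tendsto_id.atTop_div_const (by positivity)))
    have h2 : Tendsto (fun h : ℝ => y - h / (2 * Real.pi)) atTop (cocompact ℝ) :=
      h1.mono_right (by rw [cocompact_eq_atBot_atTop]; exact le_sup_left)
    simpa using (hu0.comp h2).const_mul (Φ y)

/-- A local pseudofunction satisfies the Riemann–Lebesgue property on every test function: a
partition of unity reduces to test functions supported where it is a pseudofunction. -/
lemma IsLocalPseudofunction.tendsto_modulate {U : TopologicalSpace.Opens ℝ} {g : 𝓓(U, ℂ) →L[ℂ] ℂ}
    (hg : IsLocalPseudofunction g) (φ : 𝓓(U, ℂ)) :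
    Tendsto (fun h : ℝ => g (modulate h φ)) atTop (𝓝 0) := by
  choose V hVo hVt hVU f hf hfg using fun t : U => hg t t.2
  obtain ⟨T, hT⟩ := φ.hasCompactSupport.isCompact.elim_finite_subcover (U := V) hVo
    (fun t ht => mem_iUnion.2 ⟨⟨t, φ.tsupport_subset ht⟩, hVt _⟩)
  obtain ⟨ρ, hρ⟩ := SmoothPartitionOfUnity.exists_isSubordinate (modelWithCornersSelf ℝ ℝ)
    (isClosed_tsupport (φ : ℝ → ℂ)) (fun i : T => V i) (fun i => hVo i)
    (by simpa [iUnion_subtype] using hT)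
  have hsm : ∀ i : T, ContDiff ℝ (⊤ : ℕ∞) (fun t : ℝ => (ρ i t : ℂ)) := fun i =>
    Complex.ofRealCLM.contDiff.comp (ρ i).contMDiff.contDiff
  have hsum : φ = ∑ i : T, smoothMul _ (hsm i) φ := by
    ext t
    have : (∑ i : T, smoothMul _ (hsm i) φ) t = ∑ i : T, (ρ i t : ℂ) * φ t := by
      rw [testFunction_sum_apply]
      rfl
    rw [this, ← Finset.sum_mul]
    by_cases ht : t ∈ tsupport (φ : ℝ → ℂ)
    · have := ρ.sum_eq_one ht
      rw [finsum_eq_sum_of_fintype] at this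
      rw [← Complex.ofReal_sum, this]
      simp
    · simp [image_eq_zero_of_notMem_tsupport ht]
  have hmod : ∀ h : ℝ, g (modulate h φ) = ∑ i : T, g (modulate h (smoothMul _ (hsm i) φ)) := by
    intro h
    rw [← map_sum]
    congr 1
    ext t
    conv_lhs => rw [hsum]
    simp only [modulate_apply, testFunction_sum_apply, Finset.mul_sum]
  simp_rw [hmod]
  rw [show (0 : ℂ) = ∑ i : T, (0 : ℂ) by simp]
  refine tendsto_finsetSum _ fun i _ => ?_
  have hsupp : ∀ h : ℝ, tsupport (modulate h (smoothMul _ (hsm i) φ) : ℝ → ℂ) ⊆ V i := by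
    intro h
    refine Subset.trans ?_ (hρ i)
    refine closure_mono fun t ht => ?_
    rw [Function.mem_support] at ht ⊢
    rintro h0
    apply ht
    simp [modulate_apply, h0]
  simp_rw [fun h => hfg i _ (hsupp h)]
  exact tendsto_pseudofunction_modulate (hf i) _

/-! ### Slow decrease and lower bounds -/

/-- In terms of `q x = S x / e^x`, log-linear slow decrease reads
`q (x + h) ≥ e^{-h} (q x - ε)`. -/
lemma LogLinearlySlowlyDecreasing.exp_neg_mul_le {S : ℝ → ℝ} (hS : LogLinearlySlowlyDecreasing S)
    {ε : ℝ} (hε : 0 < ε) : ∃ δ : ℝ, 0 < δ ∧ ∃ x₀ : ℝ, ∀ x, x₀ ≤ x → ∀ h, 0 ≤ h → h ≤ δ →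
      Real.exp (-h) * (S x / Real.exp x - ε) ≤ S (x + h) / Real.exp (x + h) := by
  obtain ⟨δ, hδ, x₀, H⟩ := hS ε hε
  refine ⟨δ, hδ, x₀, fun x hx h h0 h1 => ?_⟩
  have h2 := H x hx h h0 h1
  have h3 : S (x + h) / Real.exp (x + h) = Real.exp (-h) * (S (x + h) / Real.exp x) := by
    rw [Real.exp_add, Real.exp_neg]
    field_simp
  rw [h3]
  rw [sub_div] at h2
  exact mul_le_mul_of_nonneg_left (by linarith) (Real.exp_pos _).le

/-- Slow decrease alone bounds `S x / e^x` from below: over a step of fixed length the lower bound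
deteriorates by an affine contraction. -/
lemma LogLinearlySlowlyDecreasing.exists_lower_bound {S : ℝ → ℝ}
    (hS : LogLinearlySlowlyDecreasing S) :
    ∃ C x₀ : ℝ, 0 ≤ C ∧ 0 ≤ x₀ ∧ ∀ x, x₀ ≤ x → -C ≤ S x / Real.exp x := by
  obtain ⟨δ, hδ, x₁, H⟩ := hS.exp_neg_mul_le one_pos
  set q : ℝ → ℝ := fun x => S x / Real.exp x with hq
  set x₀ := max x₁ 0 with hx₀
  have hr : Real.exp (-δ) < 1 := by rw [Real.exp_lt_one_iff]; linarith
  have hr0 := Real.exp_pos (-δ)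
  -- `1 / (1 - e^{-δ})` makes the bound `-C` stable under a step of length `δ`.
  set C := max (|q x₀| + 1) (1 / (1 - Real.exp (-δ))) with hC
  have hC1 : |q x₀| + 1 ≤ C := le_max_left _ _
  have hC2 : 1 ≤ C * (1 - Real.exp (-δ)) := by
    rw [← div_le_iff₀ (by linarith)]
    exact le_max_right _ _
  have hC0 : 0 ≤ C := by positivity
  have hstep : ∀ n : ℕ, ∀ h, 0 ≤ h → h ≤ δ → -C ≤ q (x₀ + n * δ + h) := by
    intro n
    induction n with
    | zero =>
      intro h h0 h1
      have h2 := H x₀ (le_max_left _ _) h h0 h1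
      have h3 : Real.exp (-h) ≤ 1 := by rw [Real.exp_le_one_iff]; linarith
      have h4 := neg_abs_le (q x₀)
      have h5 := Real.exp_pos (-h)
      have h6 : -(|q x₀| + 1) ≤ Real.exp (-h) * (q x₀ - 1) := by
        nlinarith [abs_nonneg (q x₀)]
      simp only [Nat.cast_zero, zero_mul, add_zero]
      linarith
    | succ n ih =>
      intro h h0 h1
      have h2 := ih h h0 h1
      have h3 := H (x₀ + n * δ + h) (by
        have : 0 ≤ (n : ℝ) * δ := by positivity
        have := le_max_left x₁ 0
        linarith) δ hδ.le le_rfl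
      have h4 : x₀ + (↑(n + 1) : ℝ) * δ + h = x₀ + n * δ + h + δ := by push_cast; ring
      rw [h4]
      refine le_trans ?_ h3
      change -C ≤ Real.exp (-δ) * (q _ - 1)
      nlinarith
  refine ⟨C, x₀, hC0, le_max_right _ _, fun x hx => ?_⟩
  have h1 : 0 ≤ (x - x₀) / δ := div_nonneg (by linarith) hδ.le
  have h2 := Nat.floor_le h1
  have h3 := Nat.lt_floor_add_one ((x - x₀) / δ)
  rw [le_div_iff₀ hδ] at h2
  rw [div_lt_iff₀ hδ] at h3
  have := hstep ⌊(x - x₀) / δ⌋₊ (x - x₀ - ⌊(x - x₀) / δ⌋₊ * δ) (by linarith) (by linarith)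
  rwa [show x₀ + ⌊(x - x₀) / δ⌋₊ * δ + (x - x₀ - ⌊(x - x₀) / δ⌋₊ * δ) = x by ring] at this

/-! ### A Tauberian theorem for averages against a kernel -/

/-- The averages of `F` against every dilate of the kernel `K` exist and tend to `0` as the
centre moves to `+∞`. -/
def AveragesVanish (K F : ℝ → ℝ) : Prop :=
  (∀ l : ℝ, 0 < l → ∀ h : ℝ, Integrable (fun x => F x * K (l * (x - h)))) ∧
  ∀ l : ℝ, 0 < l → Tendsto (fun h : ℝ => ∫ x, F x * K (l * (x - h))) atTop (𝓝 0)

/-- A nonnegative continuous kernel of mass one that is positive at the origin and vanishes at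
infinity. -/
structure IsAveragingKernel (K : ℝ → ℝ) : Prop where
  nonneg : ∀ x, 0 ≤ K x
  continuous : Continuous K
  integrable : Integrable K
  integral_eq_one : ∫ x, K x = 1
  pos_zero : 0 < K 0
  tendsto_zero : Tendsto K (cocompact ℝ) (𝓝 0)

namespace IsAveragingKernel

variable {K : ℝ → ℝ}

lemma exists_bound (hK : IsAveragingKernel K) : ∃ B : ℝ, ∀ x, K x ≤ B := by
  obtain ⟨x, hx⟩ := hK.continuous.exists_forall_ge' 0
    ((hK.tendsto_zero.eventually (gt_mem_nhds hK.pos_zero)).mono fun _ h => h.le)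
  exact ⟨K x, hx⟩

lemma integrable_dilate (hK : IsAveragingKernel K) {l : ℝ} (hl : 0 < l) (h : ℝ) :
    Integrable (fun x => K (l * (x - h))) :=
  (hK.integrable.comp_mul_left' hl.ne').comp_sub_right h

lemma integral_dilate (hK : IsAveragingKernel K) {l : ℝ} (hl : 0 < l) (h : ℝ) :
    l * ∫ x, K (l * (x - h)) = 1 := by
  rw [integral_sub_right_eq_self (fun x => K (l * x)) h, Measure.integral_comp_mul_left,
    hK.integral_eq_one, abs_of_pos (by positivity)]
  simp [hl.ne']

lemma averagesVanish_of_integrable (hK : IsAveragingKernel K) {F : ℝ → ℝ} (hF : Integrable F) :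
    AveragesVanish K F := by
  obtain ⟨B, hB⟩ := hK.exists_bound
  have hBn : ∀ x, ‖K x‖ ≤ B := fun x => by rw [Real.norm_of_nonneg (hK.nonneg x)]; exact hB x
  have hmeas : ∀ l h : ℝ, AEStronglyMeasurable (fun x => K (l * (x - h))) volume := fun l h =>
    (hK.continuous.comp (by fun_prop)).aestronglyMeasurable
  refine ⟨fun l hl h => hF.mul_bdd (c := B) (hmeas l h) (.of_forall fun x => hBn _), fun l hl => ?_⟩
  have key := tendsto_integral_filter_of_dominated_convergence (μ := volume) (l := atTop)
    (F := fun (h : ℝ) x => F x * K (l * (x - h))) (f := fun _ => (0 : ℝ))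
    (fun x => ‖F x‖ * B) ?_ ?_ (hF.norm.mul_const _) ?_
  · simpa using key
  · exact .of_forall fun h => hF.1.mul (hmeas l h)
  · refine .of_forall fun h => .of_forall fun x => ?_
    rw [norm_mul]
    exact mul_le_mul_of_nonneg_left (hBn _) (norm_nonneg _)
  · refine .of_forall fun x => ?_
    have h1 : Tendsto (fun h : ℝ => l * (x - h)) atTop atBot :=
      (tendsto_atBot_add_const_left _ x tendsto_neg_atTop_atBot).const_mul_atBot hl
    have h2 : Tendsto (fun h : ℝ => l * (x - h)) atTop (cocompact ℝ) :=
      h1.mono_right (by rw [cocompact_eq_atBot_atTop]; exact le_sup_left)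
    simpa using (hK.tendsto_zero.comp h2).const_mul (F x)

lemma averagesVanish_indicator (hK : IsAveragingKernel K) {F : ℝ → ℝ} (hF : AveragesVanish K F)
    {X : ℝ} (hFX : IntegrableOn F (Iic X)) : AveragesVanish K ((Ioi X).indicator F) := by
  obtain ⟨h1, h2⟩ := hK.averagesVanish_of_integrable
    ((integrable_indicator_iff measurableSet_Iic).2 hFX)
  have hsplit : (Ioi X).indicator F = fun x => F x - (Iic X).indicator F x := by
    rw [← compl_Iic, indicator_compl]
    rfl
  simp only [AveragesVanish, hsplit, sub_mul]
  refine ⟨fun l hl h => (hF.1 l hl h).sub (h1 l hl h), fun l hl => ?_⟩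
  have := (hF.2 l hl).sub (h2 l hl)
  rw [sub_zero] at this
  refine this.congr fun h => ?_
  rw [integral_sub (hF.1 l hl h) (h1 l hl h)]

/-- Under a one-sided bound, the averages against `K` control the integral of `F + C` over short
intervals; since `F + a` cannot drop quickly, its values are then bounded above. -/
lemma exists_upper_bound (hK : IsAveragingKernel K) {F : ℝ → ℝ} (hF : AveragesVanish K F)
    {C a : ℝ} (hC : ∀ x, -C ≤ F x) {δ x₀ : ℝ} (hδ : 0 < δ)
    (hq : ∀ x, x₀ ≤ x → ∀ h, 0 ≤ h → h ≤ δ → Real.exp (-h) * (F x + a - 1) ≤ F (x + h) + a) :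
    ∃ M X : ℝ, ∀ x, X ≤ x → F x ≤ M := by
  obtain ⟨r, hr, hrK⟩ := Metric.eventually_nhds_iff.1
    (hK.continuous.continuousAt.eventually (lt_mem_nhds (half_lt_self hK.pos_zero)))
  set c := K 0 / 2 with hc
  have hc0 : 0 < c := half_pos hK.pos_zero
  set d := min (r / 2) δ with hd
  have hd0 : 0 < d := lt_min (by linarith) hδ
  have hKc : ∀ u, 0 ≤ u → u ≤ d → c ≤ K u := fun u hu0 hu1 => by
    refine (hrK ?_).le
    rw [Real.dist_eq, sub_zero, abs_of_nonneg hu0]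
    linarith [min_le_left (r / 2) δ]
  obtain ⟨X, hX⟩ := eventually_atTop.1
    ((hF.2 1 one_pos).eventually (gt_mem_nhds (zero_lt_one' ℝ)))
  have hed := Real.exp_pos d
  refine ⟨max (1 - a) (1 - a + Real.exp d * ((1 + C) / (d * c) + a - C)) + Real.exp d * |a - C|,
    max X x₀, fun h hh => ?_⟩
  have hnn : 0 ≤ Real.exp d * |a - C| := by positivity
  set Y := Real.exp (-d) * (F h + a - 1) - a + C with hY
  have hFY : F h = 1 - a + Real.exp d * (Y + a - C) := by
    rw [hY, Real.exp_neg]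
    field_simp
    ring
  rcases le_or_gt (F h + a) 1 with h1 | h1
  · have := le_max_left (1 - a) (1 - a + Real.exp d * ((1 + C) / (d * c) + a - C))
    linarith
  rcases le_or_gt Y 0 with hY0 | hY0
  · have h2 : Real.exp d * (Y + a - C) ≤ Real.exp d * |a - C| :=
      mul_le_mul_of_nonneg_left (by linarith [le_abs_self (a - C)]) hed.le
    have := le_max_left (1 - a) (1 - a + Real.exp d * ((1 + C) / (d * c) + a - C))
    linarith
  have hKh := hK.integrable_dilate one_pos h
  have hKi := hK.integral_dilate one_pos h
  simp only [one_mul] at hKh hKi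
  have hFh := hF.1 1 one_pos h
  have hFl := hX h ((le_max_left _ _).trans hh)
  simp only [one_mul] at hFh hFl
  have hmono : ∫ x, (Icc h (h + d)).indicator (fun _ => c * Y) x ≤
      ∫ x, (F x * K (x - h) + C * K (x - h)) := by
    refine integral_mono ?_ (hFh.add (hKh.const_mul C)) fun x => ?_
    · rw [integrable_indicator_iff measurableSet_Icc]
      exact integrableOn_const (by simp)
    · have hpos : 0 ≤ F x * K (x - h) + C * K (x - h) := by
        rw [← add_mul]
        exact mul_nonneg (by linarith [hC x]) (hK.nonneg _)
      by_cases hx : x ∈ Icc h (h + d)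
      · rw [indicator_of_mem hx, ← add_mul, mul_comm]
        have h2 := hq h ((le_max_right _ _).trans hh) (x - h) (by linarith [hx.1])
          (by linarith [hx.2, min_le_right (r / 2) δ])
        have h3 : Real.exp (-d) * (F h + a - 1) ≤ Real.exp (-(x - h)) * (F h + a - 1) :=
          mul_le_mul_of_nonneg_right (Real.exp_le_exp.2 (by linarith [hx.2])) (by linarith)
        rw [add_sub_cancel] at h2
        exact mul_le_mul (by linarith) (hKc _ (by linarith [hx.1]) (by linarith [hx.2])) hc0.le
          (by linarith [hC x])
      · rw [indicator_of_notMem hx]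
        exact hpos
  rw [integral_indicator measurableSet_Icc, setIntegral_const, integral_add hFh (hKh.const_mul C),
    integral_const_mul, hKi, Real.volume_real_Icc_of_le (by linarith), smul_eq_mul] at hmono
  have hYle : Y ≤ (1 + C) / (d * c) := by
    rw [le_div_iff₀ (by positivity)]
    linarith
  have h2 : Real.exp d * (Y + a - C) ≤ Real.exp d * ((1 + C) / (d * c) + a - C) :=
    mul_le_mul_of_nonneg_left (by linarith) hed.le
  have := le_max_right (1 - a) (1 - a + Real.exp d * ((1 + C) / (d * c) + a - C))
  linarith

/-- Sufficiently concentrated dilates of `K` have arbitrarily small mass outside `[-δ, δ]`. -/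
lemma exists_dilate_tail_le (hK : IsAveragingKernel K) {δ ε : ℝ} (hδ : 0 < δ) (hε : 0 < ε) :
    ∃ l : ℝ, 0 < l ∧ ∀ c : ℝ,
      l * ∫ x, {x | δ < |x - c|}.indicator (fun x => K (l * (x - c))) x ≤ ε := by
  have hmeas : ∀ s : ℝ, MeasurableSet {v : ℝ | s < |v|} := fun s =>
    measurableSet_lt measurable_const measurable_norm
  have key := tendsto_integral_filter_of_dominated_convergence (μ := volume) (l := atTop)
    (F := fun (l : ℝ) v => {v : ℝ | l * δ < |v|}.indicator K v) (f := fun _ => (0 : ℝ))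
    K ?_ ?_ hK.integrable ?_
  · rw [integral_zero] at key
    obtain ⟨l, hl, hl0⟩ := ((key.eventually (gt_mem_nhds hε)).and (eventually_gt_atTop 0)).exists
    refine ⟨l, hl0, fun c => ?_⟩
    have h1 : ∀ x, {x | δ < |x - c|}.indicator (fun x => K (l * (x - c))) x =
        {v : ℝ | l * δ < |v|}.indicator K (l * (x - c)) := by
      intro x
      simp only [indicator, mem_ofPred_eq, abs_mul, abs_of_pos hl0, mul_lt_mul_iff_right₀ hl0]
    simp_rw [h1]
    rw [integral_sub_right_eq_self (fun x => {v : ℝ | l * δ < |v|}.indicator K (l * x)) c,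
      Measure.integral_comp_mul_left, abs_of_pos (by positivity), smul_eq_mul,
      mul_inv_cancel_left₀ hl0.ne']
    exact hl.le
  · exact .of_forall fun l => (hK.continuous.aestronglyMeasurable.indicator (hmeas _))
  · refine .of_forall fun l => .of_forall fun v => ?_
    refine (norm_indicator_le_norm_self _ _).trans_eq (Real.norm_of_nonneg (hK.nonneg v))
  · refine .of_forall fun v => tendsto_const_nhds.congr' ?_
    filter_upwards [eventually_ge_atTop (|v| / δ)] with l hl
    rw [indicator_of_notMem]
    rw [div_le_iff₀ hδ] at hl
    simpa using hl

/-- A bounded function with vanishing averages cannot exceed a positive level on arbitrarily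
remote intervals of a fixed length. -/
lemma exists_level_le (hK : IsAveragingKernel K) {F : ℝ → ℝ} (hF : AveragesVanish K F) {M : ℝ}
    (hM : ∀ x, |F x| ≤ M) {δ ε B : ℝ} (hδ : 0 < δ) (hε : 0 < ε) :
    ∃ X : ℝ, ∀ c, X ≤ c → ∀ A : ℝ, |A| ≤ B → (∀ x, |x - c| ≤ δ → A ≤ F x) → A ≤ ε := by
  have hM0 : 0 ≤ M := (abs_nonneg _).trans (hM 0)
  obtain ⟨l, hl, hτ⟩ := hK.exists_dilate_tail_le hδ
    (show 0 < ε / 2 / (|B| + M + 1) by positivity)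
  obtain ⟨X, hX⟩ := eventually_atTop.1
    (((hF.2 l hl).const_mul l).eventually
      (gt_mem_nhds (show l * 0 < ε / 2 by simpa using half_pos hε)))
  refine ⟨X, fun c hc A hA hAF => ?_⟩
  have hKc := hK.integrable_dilate hl c
  have hind : Integrable ({x | δ < |x - c|}.indicator (fun x => K (l * (x - c)))) :=
    hKc.indicator (measurableSet_lt measurable_const (by fun_prop))
  have hmono : ∫ x, (A * K (l * (x - c)) -
      (|A| + M) * {x | δ < |x - c|}.indicator (fun x => K (l * (x - c))) x) ≤
      ∫ x, F x * K (l * (x - c)) := by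
    refine integral_mono ((hKc.const_mul A).sub (hind.const_mul _)) (hF.1 l hl c) fun x => ?_
    have hk := hK.nonneg (l * (x - c))
    by_cases hx : δ < |x - c|
    · simp only [indicator_of_mem (show x ∈ {x | δ < |x - c|} from hx)]
      rw [← sub_mul]
      exact mul_le_mul_of_nonneg_right
        (by linarith [le_abs_self A, neg_abs_le (F x), hM x]) hk
    · simp only [indicator_of_notMem (show x ∉ {x | δ < |x - c|} from hx), mul_zero, sub_zero]
      exact mul_le_mul_of_nonneg_right (hAF x (not_lt.1 hx)) hk
  rw [integral_sub (hKc.const_mul A) (hind.const_mul _), integral_const_mul,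
    integral_const_mul] at hmono
  have h1 := mul_le_mul_of_nonneg_left hmono hl.le
  have h2 := hK.integral_dilate hl c
  have h3 := hX c hc
  have h4 := hτ c
  set τ := l * ∫ x, {x | δ < |x - c|}.indicator (fun x => K (l * (x - c))) x with hτd
  have h5 : l * (A * ∫ x, K (l * (x - c))) = A := by rw [mul_left_comm, h2, mul_one]
  have h6 : (|A| + M) * τ ≤ ε / 2 := by
    have : |A| + M ≤ |B| + M + 1 := by linarith [le_abs_self B]
    have hs := mul_le_mul this h4 (mul_nonneg hl.le (integral_nonneg
      fun x => indicator_nonneg (fun _ _ => hK.nonneg _) x)) (by positivity)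
    rwa [mul_div_cancel₀ _ (by positivity)] at hs
  rw [mul_sub, h5, mul_left_comm, ← hτd] at h1
  linarith

/-- A bounded, slowly decreasing function with vanishing averages tends to zero. -/
lemma tendsto_zero_of_bounded (hK : IsAveragingKernel K) {F : ℝ → ℝ} (hF : AveragesVanish K F)
    {M : ℝ} (hM : ∀ x, |F x| ≤ M)
    (hq : ∀ ε : ℝ, 0 < ε → ∃ δ : ℝ, 0 < δ ∧ ∃ x₀ : ℝ, ∀ x, x₀ ≤ x → ∀ h, 0 ≤ h → h ≤ δ →
      F x - ε ≤ F (x + h)) :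
    Tendsto F atTop (𝓝 0) := by
  have hFneg : AveragesVanish K (fun x => -F x) := by
    simp only [AveragesVanish, neg_mul]
    refine ⟨fun l hl h => (hF.1 l hl h).neg, fun l hl => ?_⟩
    simp_rw [integral_neg]
    simpa using (hF.2 l hl).neg
  rw [Metric.tendsto_atTop]
  intro ε hε
  obtain ⟨δ, hδ, x₀, H⟩ := hq (ε / 3) (by positivity)
  obtain ⟨X₁, h₁⟩ := hK.exists_level_le hF hM (δ := δ / 2) (ε := ε / 3) (B := M + ε)
    (by positivity) (by positivity)
  obtain ⟨X₂, h₂⟩ := hK.exists_level_le hFneg (M := M) (by simpa using hM) (δ := δ / 2)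
    (ε := ε / 3) (B := M + ε) (by positivity) (by positivity)
  refine ⟨max (max X₁ X₂) x₀ + δ, fun h hh => ?_⟩
  have hb := abs_le.1 (hM h)
  have e1 := le_max_left (max X₁ X₂) x₀
  have e2 := le_max_right (max X₁ X₂) x₀
  have e3 := le_max_left X₁ X₂
  have e4 := le_max_right X₁ X₂
  have hup := h₁ (h + δ / 2) (by linarith) (F h - ε / 3)
    (abs_le.2 ⟨by linarith, by linarith⟩) (fun x hx => by
      have := abs_le.1 hx
      have := H h (by linarith) (x - h) (by linarith) (by linarith)
      rwa [add_sub_cancel] at this)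
  have hlo := h₂ (h - δ / 2) (by linarith) (-F h - ε / 3)
    (abs_le.2 ⟨by linarith, by linarith⟩) (fun x hx => by
      have := abs_le.1 hx
      have := H x (by linarith) (h - x) (by linarith) (by linarith)
      rw [add_sub_cancel] at this
      linarith)
  rw [Real.dist_eq, sub_zero, abs_lt]
  constructor <;> linarith

/-- The real-variable Tauberian theorem: vanishing averages, a lower bound and slow decrease force
`F → 0`. Boundedness is obtained first, and turns the multiplicative form of slow decrease into the
additive one. -/
theorem tendsto_zero_of_averagesVanish (hK : IsAveragingKernel K) {F : ℝ → ℝ}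
    (hF : AveragesVanish K F) (hFi : ∀ X : ℝ, IntegrableOn F (Iic X)) {C x₁ a : ℝ} (hC0 : 0 ≤ C)
    (hC : ∀ x, x₁ ≤ x → -C ≤ F x)
    (hq : ∀ ε : ℝ, 0 < ε → ∃ δ : ℝ, 0 < δ ∧ ∃ x₀ : ℝ, ∀ x, x₀ ≤ x → ∀ h, 0 ≤ h → h ≤ δ →
      Real.exp (-h) * (F x + a - ε) ≤ F (x + h) + a) :
    Tendsto F atTop (𝓝 0) := by
  have hbound : ∃ M X : ℝ, ∀ x, X ≤ x → F x ≤ M := by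
    obtain ⟨δ, hδ, x₀, H⟩ := hq 1 one_pos
    have hge : ∀ x, x₁ < x → (Ioi x₁).indicator F x = F x := fun x hx => indicator_of_mem hx F
    obtain ⟨M, X, hMX⟩ := hK.exists_upper_bound (hK.averagesVanish_indicator hF (hFi x₁))
      (C := C) (a := a) (x₀ := max x₀ (x₁ + 1)) (fun x => by
        by_cases hx : x₁ < x
        · rw [hge x hx]
          exact hC x hx.le
        · rw [indicator_of_notMem (by simpa using hx)]
          linarith) hδ (fun x hx h h0 h1 => by
        have := le_max_left x₀ (x₁ + 1)
        have := le_max_right x₀ (x₁ + 1)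
        rw [hge x (by linarith), hge _ (by linarith)]
        exact H x (by linarith) h h0 h1)
    refine ⟨M, max X (x₁ + 1), fun x hx => ?_⟩
    rw [← hge x (by linarith [le_max_right X (x₁ + 1)])]
    exact hMX x ((le_max_left _ _).trans hx)
  obtain ⟨M, X, hMX⟩ := hbound
  set X' := max X x₁ with hX'
  set D := max |M| C with hD
  have hDn : 0 ≤ D := (abs_nonneg _).trans (le_max_left _ _)
  have hFD : ∀ x, X' ≤ x → |F x| ≤ D := fun x hx => abs_le.2
    ⟨by linarith [hC x ((le_max_right _ _).trans hx), le_max_right |M| C],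
      (hMX x ((le_max_left _ _).trans hx)).trans ((le_abs_self M).trans (le_max_left _ _))⟩
  have hge : ∀ x, X' < x → (Ioi X').indicator F x = F x := fun x hx => indicator_of_mem hx F
  have hlim := hK.tendsto_zero_of_bounded (hK.averagesVanish_indicator hF (hFi X')) (M := D)
    (fun x => by
      by_cases hx : X' < x
      · rw [hge x hx]
        exact hFD x hx.le
      · rw [indicator_of_notMem (by simpa using hx)]
        simpa using hDn) (fun ε hε => by
      obtain ⟨δ, hδ, x₀, H⟩ := hq (ε / 2) (by positivity)
      -- For `0 ≤ h ≤ η` one has `(1 - e^{-h}) |F x + a| ≤ h (D + |a|) ≤ ε / 2`.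
      set η := ε / 2 / (D + |a| + 1) with hη
      have hη0 : 0 < η := by positivity
      refine ⟨min δ η, lt_min hδ hη0, max x₀ (X' + 1), fun x hx h h0 h1 => ?_⟩
      have e1 := le_max_left x₀ (X' + 1)
      have e2 := le_max_right x₀ (X' + 1)
      rw [hge x (by linarith), hge _ (by linarith)]
      have h2 := H x (by linarith) h h0 (h1.trans (min_le_left _ _))
      have h3 : h * (D + |a| + 1) ≤ ε / 2 := by
        rw [← le_div_iff₀ (by positivity)]
        exact h1.trans (min_le_right _ _)
      have h4 : 1 - h ≤ Real.exp (-h) := by linarith [Real.add_one_le_exp (-h)]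
      have h5 : Real.exp (-h) ≤ 1 := by rw [Real.exp_le_one_iff]; linarith
      have h6 : F x + a ≤ D + |a| :=
        add_le_add ((le_abs_self _).trans (hFD x (by linarith))) (le_abs_self a)
      have h7 : (1 - Real.exp (-h)) * (F x + a) ≤ h * (D + |a| + 1) :=
        (mul_le_mul_of_nonneg_left h6 (by linarith)).trans
          (mul_le_mul (by linarith) (by linarith) (by positivity) h0)
      have h8 : Real.exp (-h) * (ε / 2) ≤ ε / 2 := by
        have := mul_le_mul_of_nonneg_right h5 (half_pos hε).le
        linarith
      linarith)
  refine hlim.congr' ?_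
  filter_upwards [eventually_gt_atTop X'] with x hx using hge x hx

end IsAveragingKernel

/-! ### Kernels with compactly supported Fourier transform -/

/-- The transform of an even real-valued function is real. -/
lemma angularFourier_ofReal_of_even {η : ℝ → ℝ} (hη : ∀ t, η (-t) = η t) (x : ℝ) :
    angularFourier (fun t => (η t : ℂ)) x = ((angularFourier (fun t => (η t : ℂ)) x).re : ℂ) := by
  refine (Complex.conj_eq_iff_re.1 ?_).symm
  unfold angularFourier
  rw [← integral_conj, ← integral_neg_eq_self]
  congr 1 with t
  rw [map_mul, Complex.conj_ofReal, hη, ← Complex.exp_conj]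
  congr 2
  simp

/-- The kernel is `|η̂|²`, suitably normalised, for an even bump function `η`: it is the transform
of the smooth compactly supported function `η ⋆ η`. -/
lemma exists_averagingKernel : ∃ K : ℝ → ℝ, IsAveragingKernel K ∧
    ∃ φ : 𝓓((⊤ : TopologicalSpace.Opens ℝ), ℂ), ∀ x, angularFourier φ x = (K x : ℂ) := by
  let η : ContDiffBump (0 : ℝ) := default
  set e : ℝ → ℂ := fun t => (η t : ℂ) with he
  have hec : Continuous e := Complex.continuous_ofReal.comp η.continuous
  have hes : HasCompactSupport e := η.hasCompactSupport.comp_left (g := Complex.ofReal) rfl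
  have hed : ContDiff ℝ (⊤ : ℕ∞) e := Complex.ofRealCLM.contDiff.comp η.contDiff
  have hei : Integrable e := hec.integrable_of_hasCompactSupport hes
  set H : ℝ → ℝ := fun x => (angularFourier e x).re with hH
  have hHe : ∀ x, angularFourier e x = (H x : ℂ) := angularFourier_ofReal_of_even η.neg
  let ψ : 𝓓((⊤ : TopologicalSpace.Opens ℝ), ℂ) :=
    { toFun := convolution e e (ContinuousLinearMap.mul ℝ ℂ) volume
      contDiff' := hes.contDiff_convolution_right _ hei.locallyIntegrable hed
      hasCompactSupport' := hes.convolution _ hes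
      tsupport_subset' := fun _ _ => trivial }
  have hψ : ∀ x, angularFourier ψ x = ((H x ^ 2 : ℝ) : ℂ) := by
    intro x
    have h1 : (ψ : ℝ → ℂ) = convolution e e (ContinuousLinearMap.mul ℂ ℂ) volume := rfl
    rw [h1, angularFourier_eq_fourier, Real.fourier_mul_convolution_eq hei hei,
      ← angularFourier_eq_fourier, hHe]
    push_cast
    ring
  have hre : ∀ x, H x ^ 2 = (angularFourier ψ x).re := fun x => by rw [hψ, Complex.ofReal_re]
  have hcont : Continuous fun x => H x ^ 2 := by
    simp_rw [hre]
    exact Complex.continuous_re.comp (continuous_angularFourier ψ)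
  have hint : Integrable fun x => H x ^ 2 := by
    simp_rw [hre]
    exact (integrable_angularFourier ψ).re
  have h0 : 0 < H 0 := by
    have : angularFourier e 0 = ((∫ t, η t : ℝ) : ℂ) := by
      rw [← integral_complex_ofReal]
      simp [angularFourier, he]
    rw [hH]
    simp only [this, Complex.ofReal_re]
    exact η.integral_pos
  have hpos : 0 < ∫ x, H x ^ 2 := by
    rw [integral_pos_iff_support_of_nonneg (fun x => sq_nonneg _) hint]
    exact hcont.isOpen_support.measure_pos volume ⟨0, by simpa using h0.ne'⟩
  set c := (∫ x, H x ^ 2)⁻¹ with hc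
  have hc0 : 0 < c := inv_pos.2 hpos
  have hzero : Tendsto (fun x => c * H x ^ 2) (cocompact ℝ) (𝓝 0) := by
    simp_rw [hre]
    simpa using ((Complex.continuous_re.tendsto 0).comp (tendsto_angularFourier ψ)).const_mul c
  have hone : ∫ x, c * H x ^ 2 = 1 := by rw [integral_const_mul, hc, inv_mul_cancel₀ hpos.ne']
  have hφ : ∀ x, angularFourier (smoothMul (fun _ => (c : ℂ)) contDiff_const ψ) x =
      ((c * H x ^ 2 : ℝ) : ℂ) := by
    intro x
    rw [Complex.ofReal_mul, ← hψ x]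
    simp only [angularFourier, smoothMul_apply]
    rw [← integral_const_mul]
    congr 1 with t
    ring
  clear_value H c ψ
  exact ⟨fun x => c * H x ^ 2,
    { nonneg := fun x => mul_nonneg hc0.le (sq_nonneg _)
      continuous := hcont.const_mul c
      integrable := hint.const_mul c
      integral_eq_one := hone
      pos_zero := mul_pos hc0 (pow_pos h0 2)
      tendsto_zero := hzero }, _, hφ⟩

/-- Dilating the transform of a test function gives the transform of a test function. -/
lemma exists_angularFourier_dilate (φ : 𝓓((⊤ : TopologicalSpace.Opens ℝ), ℂ)) {l : ℝ}
    (hl : 0 < l) : ∃ ψ : 𝓓((⊤ : TopologicalSpace.Opens ℝ), ℂ),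
      ∀ x, angularFourier ψ x = angularFourier φ (l * x) := by
  have hsupp : HasCompactSupport fun t : ℝ => (l⁻¹ : ℂ) * φ (l⁻¹ * t) :=
    (φ.hasCompactSupport.comp_homeomorph (Homeomorph.mulLeft₀ l⁻¹ (by positivity))).mul_left
  refine ⟨⟨fun t => (l⁻¹ : ℂ) * φ (l⁻¹ * t), contDiff_const.mul (φ.contDiff.comp
    (contDiff_const.mul contDiff_id)), hsupp, fun _ _ => trivial⟩, fun x => ?_⟩
  · change ∫ t : ℝ, Complex.exp (-(Complex.I * x * t)) * ((l⁻¹ : ℂ) * φ (l⁻¹ * t)) =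
      ∫ t : ℝ, Complex.exp (-(Complex.I * ((l * x : ℝ) : ℂ) * t)) * φ t
    have h := Measure.integral_comp_mul_left
      (fun s : ℝ => Complex.exp (-(Complex.I * ((l * x : ℝ) : ℂ) * s)) * φ s) l⁻¹
    rw [inv_inv, abs_of_pos hl] at h
    rw [← inv_smul_smul₀ hl.ne' (∫ t : ℝ, Complex.exp (-(Complex.I * ((l * x : ℝ) : ℂ) * t)) * φ t),
      ← h, Complex.real_smul, ← integral_const_mul]
    congr 1 with t
    have hl' : (l : ℂ) ≠ 0 := by exact_mod_cast hl.ne'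
    push_cast
    rw [mul_left_comm]
    congr 3
    field_simp

/-! ### Laplace transforms -/

/-- The error term `e^{-x} S(x) - a` on the positive half-line, extended by zero. -/
noncomputable def remainder (S : ℝ → ℝ) (a : ℝ) : ℝ → ℝ :=
  (Ioi 0).indicator fun x => S x / Real.exp x - a

lemma remainder_of_pos {S : ℝ → ℝ} {a x : ℝ} (hx : 0 < x) :
    remainder S a x = S x / Real.exp x - a := indicator_of_mem hx _

lemma remainder_of_nonpos {S : ℝ → ℝ} {a x : ℝ} (hx : x ≤ 0) : remainder S a x = 0 :=
  indicator_of_notMem (by simpa using hx) _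

lemma integrableOn_Ioc_exp_mul {S : ℝ → ℝ} (hS : LocallyIntegrableOn S (Ici (0 : ℝ)) volume)
    (σ T : ℝ) : IntegrableOn (fun x => Real.exp (-σ * x) * S x) (Ioc 0 T) := by
  have h1 : IntegrableOn S (Icc 0 T) :=
    hS.integrableOn_compact_subset Icc_subset_Ici_self isCompact_Icc
  exact (IntegrableOn.continuousOn_mul (by fun_prop) h1 isCompact_Icc).mono_set Ioc_subset_Icc_self

lemma laplacePartial_ofReal (S : ℝ → ℝ) (σ T : ℝ) :
    laplacePartial S σ T = ((∫ x in (0 : ℝ)..T, Real.exp (-σ * x) * S x : ℝ) : ℂ) := by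
  rw [laplacePartial, ← intervalIntegral.integral_ofReal]
  simp

/-- If `S x ≥ -C e^x` for large `x`, convergence of the Laplace integral at a real point to the
right of `1` is absolute. -/
lemma integrableOn_exp_mul_of_laplaceConverges {S : ℝ → ℝ}
    (hS : LocallyIntegrableOn S (Ici (0 : ℝ)) volume) {C x₀ : ℝ} (hx₀ : 0 ≤ x₀)
    (hC : ∀ x, x₀ ≤ x → -C ≤ S x / Real.exp x) {σ : ℝ} (hσ : 1 < σ) (hL : LaplaceConverges S σ) :
    IntegrableOn (fun x => Real.exp (-σ * x) * S x) (Ioi 0) := by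
  obtain ⟨L, hL⟩ := hL
  set k : ℝ → ℝ := fun x => Real.exp (-σ * x) * S x with hk
  set m : ℝ → ℝ := fun x => C * Real.exp (-(σ - 1) * x) with hm
  have hkI : ∀ T, IntegrableOn k (Ioc 0 T) := integrableOn_Ioc_exp_mul hS σ
  have hmI : IntegrableOn m (Ioi 0) :=
    (exp_neg_integrableOn_Ioi 0 (sub_pos.2 hσ)).const_mul C
  have hlim : Tendsto (fun T => ∫ x in (0 : ℝ)..T, k x) atTop (𝓝 L.re) := by
    have := (Complex.continuous_re.tendsto L).comp hL
    simpa only [Function.comp_def, laplacePartial_ofReal, Complex.ofReal_re] using this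
  have hkint : ∀ T, 0 ≤ T → IntervalIntegrable k volume 0 T := fun T hT =>
    (intervalIntegrable_iff_integrableOn_Ioc_of_le hT).2 (hkI T)
  have hmint : ∀ T, 0 ≤ T → IntervalIntegrable m volume 0 T := fun T hT =>
    (intervalIntegrable_iff_integrableOn_Ioc_of_le hT).2 (hmI.mono_set Ioc_subset_Ioi_self)
  have hsum : IntegrableOn (fun x => k x + m x) (Ioi x₀) := by
    refine integrableOn_Ioi_of_intervalIntegral_norm_tendsto
      (L.re + (∫ x in Ioi 0, m x) - ∫ x in (0 : ℝ)..x₀, (k x + m x)) x₀ (b := id) (l := atTop)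
      (fun T => ?_) tendsto_id ?_
    · exact ((hkI T).mono_set (Ioc_subset_Ioc_left hx₀)).add
        (hmI.mono_set fun x hx => lt_of_le_of_lt hx₀ hx.1)
    · refine ((hlim.add (intervalIntegral_tendsto_integral_Ioi 0 hmI tendsto_id)).sub_const
        (∫ x in (0 : ℝ)..x₀, (k x + m x))).congr' ?_
      filter_upwards [eventually_ge_atTop x₀] with T hT
      have hT0 := hx₀.trans hT
      have h1 : ∫ x in x₀..T, ‖k x + m x‖ = ∫ x in x₀..T, (k x + m x) := by
        refine intervalIntegral.integral_congr fun x hx => ?_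
        rw [uIcc_of_le hT] at hx
        refine Real.norm_of_nonneg ?_
        have h2 := hC x hx.1
        have h3 : k x = Real.exp (-(σ - 1) * x) * (S x / Real.exp x) := by
          rw [hk, show -(σ - 1) * x = -σ * x + x by ring, Real.exp_add]
          field_simp
        rw [h3, hm]
        have := mul_le_mul_of_nonneg_left h2 (Real.exp_pos (-(σ - 1) * x)).le
        dsimp only
        linarith
      have h4 := intervalIntegral.integral_add_adjacent_intervals
        ((hkint x₀ hx₀).add (hmint x₀ hx₀))
        (((hkint x₀ hx₀).symm.trans (hkint T hT0)).add ((hmint x₀ hx₀).symm.trans (hmint T hT0)))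
      rw [intervalIntegral.integral_add (hkint T hT0) (hmint T hT0)] at h4
      simp only [id]
      rw [h1]
      linarith
  have hkx : IntegrableOn k (Ioi x₀) := by
    have := hsum.sub (hmI.mono_set (Ioi_subset_Ioi hx₀))
    refine this.congr_fun (fun x _ => ?_) measurableSet_Ioi
    simp
  rw [← Ioc_union_Ioi_eq_Ioi hx₀]
  exact (hkI x₀).union hkx

/-- The Laplace integral of `S` converges absolutely on `Re s > 1`. -/
def LaplaceAbsConverges (S : ℝ → ℝ) : Prop :=
  ∀ σ : ℝ, 1 < σ → IntegrableOn (fun x => Real.exp (-σ * x) * S x) (Ioi 0)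

lemma integrable_exp_mul_remainder {S : ℝ → ℝ} (hA : LaplaceAbsConverges S)
    (a : ℝ) {ε : ℝ} (hε : 0 < ε) :
    Integrable fun x => Real.exp (-ε * x) * remainder S a x := by
  have h : (fun x => Real.exp (-ε * x) * remainder S a x) = (Ioi 0).indicator
      (fun x => Real.exp (-(1 + ε) * x) * S x - a * Real.exp (-ε * x)) := by
    ext x
    rcases lt_or_ge 0 x with hx | hx
    · rw [indicator_of_mem (show x ∈ Ioi 0 from hx), remainder_of_pos hx,
        show -(1 + ε) * x = -ε * x - x by ring, Real.exp_sub]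
      ring
    · rw [indicator_of_notMem (by simpa using hx), remainder_of_nonpos hx, mul_zero]
  rw [h, integrable_indicator_iff measurableSet_Ioi]
  exact (hA _ (by linarith)).sub ((exp_neg_integrableOn_Ioi 0 hε).const_mul a)

lemma aestronglyMeasurable_remainder {S : ℝ → ℝ} (hA : LaplaceAbsConverges S)
    (a : ℝ) : AEStronglyMeasurable (remainder S a) volume := by
  have h := (integrable_exp_mul_remainder hA a one_pos).1
  have h2 : AEStronglyMeasurable (fun x : ℝ => Real.exp x) volume :=
    Real.continuous_exp.aestronglyMeasurable
  refine (h2.mul h).congr (.of_forall fun x => ?_)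
  simp only [Pi.mul_apply]
  rw [← mul_assoc, ← Real.exp_add]
  simp

lemma integrableOn_Iic_remainder {S : ℝ → ℝ} (hA : LaplaceAbsConverges S)
    (a X : ℝ) : IntegrableOn (remainder S a) (Iic X) := by
  have h := (integrable_exp_mul_remainder hA a one_pos).integrableOn (s := Iic X)
  refine (h.norm.const_mul (Real.exp X)).mono' (aestronglyMeasurable_remainder hA a).restrict ?_
  filter_upwards [ae_restrict_mem measurableSet_Iic] with x hx
  rw [norm_mul, Real.norm_of_nonneg (Real.exp_pos _).le, ← mul_assoc, ← Real.exp_add]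
  exact le_mul_of_one_le_left (norm_nonneg _) (Real.one_le_exp (by linarith [mem_Iic.1 hx]))

lemma integrableOn_cexp_mul {S : ℝ → ℝ} (hA : LaplaceAbsConverges S) {s : ℂ} (hs : 1 < s.re) :
    IntegrableOn (fun x : ℝ => Complex.exp (-s * x) * (S x : ℂ)) (Ioi 0) := by
  have h1 : IntegrableOn (fun x : ℝ => ((Real.exp (-s.re * x) * S x : ℝ) : ℂ)) (Ioi 0) :=
    (hA _ hs).ofReal
  have h2 : Continuous fun x : ℝ => Complex.exp (-(s.im * Complex.I) * x) := by fun_prop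
  refine (h1.bdd_mul (c := 1) h2.aestronglyMeasurable (.of_forall fun x => ?_)).congr
    (.of_forall fun x => ?_)
  · rw [Complex.norm_exp]
    simp
  · dsimp only
    push_cast
    rw [← mul_assoc, ← Complex.exp_add]
    congr 2
    conv_rhs => rw [← Complex.re_add_im s]
    ring

lemma tendsto_laplacePartial {S : ℝ → ℝ} (hA : LaplaceAbsConverges S)
    {s : ℂ} (hs : 1 < s.re) : Tendsto (laplacePartial S s) atTop
      (𝓝 (∫ x in Ioi (0 : ℝ), Complex.exp (-s * x) * (S x : ℂ))) :=
  intervalIntegral_tendsto_integral_Ioi 0 (integrableOn_cexp_mul hA hs) tendsto_id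

lemma laplace_sub_eq_integral {S : ℝ → ℝ} (hA : LaplaceAbsConverges S)
    (a : ℝ) {s : ℂ} (hs : 1 < s.re) :
    laplace S s - a / (s - 1) = ∫ x : ℝ, Complex.exp (-(s - 1) * x) * (remainder S a x : ℂ) := by
  have hre : (-(s - 1)).re < 0 := by simpa using hs
  have h1 := integral_exp_mul_complex_Ioi hre 0
  rw [laplace, (tendsto_laplacePartial hA hs).limUnder_eq]
  have h2 : (a : ℂ) / (s - 1) = ∫ x in Ioi (0 : ℝ), (a : ℂ) * Complex.exp (-(s - 1) * x) := by
    rw [integral_const_mul, h1, neg_div_neg_eq, mul_comm]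
    simp [div_eq_mul_inv, mul_comm]
  rw [h2, ← integral_sub (integrableOn_cexp_mul hA hs)
    ((integrableOn_exp_mul_complex_Ioi hre 0).const_mul _), ← integral_indicator measurableSet_Ioi]
  congr 1 with x
  rcases lt_or_ge 0 x with hx | hx
  · rw [indicator_of_mem (show x ∈ Ioi 0 from hx), remainder_of_pos hx,
      show -(s - 1) * x = -s * x + x by ring, Complex.exp_add]
    push_cast
    field_simp
  · rw [indicator_of_notMem (by simpa using hx), remainder_of_nonpos hx]
    simp

/-- Pairing the Laplace transform on a vertical line with a test function moves the transform onto
the test function. -/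
lemma integral_laplace_sub_mul {S : ℝ → ℝ} (hA : LaplaceAbsConverges S)
    (a : ℝ) {σ : ℝ} (hσ : 1 < σ) {U : TopologicalSpace.Opens ℝ} (φ : 𝓓(U, ℂ)) :
    ∫ t : ℝ, (laplace S ((σ : ℂ) + Complex.I * t) - a / ((σ : ℂ) + Complex.I * t - 1)) * φ t =
      ∫ x : ℝ, ((Real.exp (-(σ - 1) * x) * remainder S a x : ℝ) : ℂ) * angularFourier φ x := by
  have hk : Integrable fun x => ((Real.exp (-(σ - 1) * x) * remainder S a x : ℝ) : ℂ) :=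
    (integrable_exp_mul_remainder hA a (sub_pos.2 hσ)).ofReal
  have hφ : Integrable (φ : ℝ → ℂ) :=
    φ.continuous.integrable_of_hasCompactSupport φ.hasCompactSupport
  set k : ℝ → ℂ := fun x => ((Real.exp (-(σ - 1) * x) * remainder S a x : ℝ) : ℂ) with hkd
  have hprod : Integrable (Function.uncurry fun t x : ℝ =>
      Complex.exp (-(Complex.I * x * t)) * (φ t * k x)) (volume.prod volume) := by
    have hc : Continuous fun z : ℝ × ℝ => Complex.exp (-(Complex.I * z.2 * z.1)) := by fun_prop
    refine (hφ.mul_prod hk).bdd_mul (c := 1) hc.aestronglyMeasurable (.of_forall fun z => ?_)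
    rw [Complex.norm_exp]
    simp
  calc _ = ∫ t : ℝ, ∫ x : ℝ, Complex.exp (-(Complex.I * x * t)) * (φ t * k x) := by
        congr 1 with t
        rw [laplace_sub_eq_integral hA a (by simpa using hσ), ← integral_mul_const]
        congr 1 with x
        rw [hkd]
        push_cast
        rw [show -((σ : ℂ) + Complex.I * t - 1) * x = -(Complex.I * x * t) + -(σ - 1) * x by ring,
          Complex.exp_add]
        ring
    _ = ∫ x : ℝ, ∫ t : ℝ, Complex.exp (-(Complex.I * x * t)) * (φ t * k x) :=
        integral_integral_swap hprod
    _ = _ := by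
        congr 1 with x
        rw [angularFourier, ← integral_const_mul]
        congr 1 with t
        ring

/-! ### Boundary behaviour and slow decrease imply the asymptotics -/

/-- When `R` is bounded below near `+∞` and `k ≥ 0`, convergence of the damped integrals as the
damping is removed makes `R k` integrable (Fatou's lemma, since the negative part of `R k` is
integrable anyway) and identifies its integral (dominated convergence). -/
lemma integrable_mul_of_tendsto_damped {R k : ℝ → ℝ} {C x₀ L : ℝ} (hC : 0 ≤ C)
    (hR0 : ∀ x, x ≤ 0 → R x = 0)
    (hRd : ∀ ε : ℝ, 0 < ε → Integrable fun x => Real.exp (-ε * x) * R x)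
    (hRi : IntegrableOn R (Iic x₀)) (hlow : ∀ x, x₀ ≤ x → -C ≤ R x)
    (hk0 : ∀ x, 0 ≤ k x) (hkc : Continuous k) (hki : Integrable k) {B : ℝ} (hkB : ∀ x, k x ≤ B)
    (hlim : Tendsto (fun ε : ℝ => ∫ x, Real.exp (-ε * x) * R x * k x) (𝓝[>] 0) (𝓝 L)) :
    Integrable (fun x => R x * k x) ∧ ∫ x, R x * k x = L := by
  have hkn : ∀ x, ‖k x‖ ≤ B := fun x => by rw [Real.norm_of_nonneg (hk0 x)]; exact hkB x
  have hd : ∀ ε : ℝ, 0 < ε → Integrable fun x => Real.exp (-ε * x) * R x * k x := fun ε hε =>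
    (hRd ε hε).mul_bdd hkc.aestronglyMeasurable (.of_forall hkn)
  set b : ℝ → ℝ := fun x => (2 * C + 2 * (Iic x₀).indicator (fun x => |R x|) x) * k x with hb
  have hbi : Integrable b := by
    have h1 : Integrable (fun x => (Iic x₀).indicator (fun x => |R x|) x * k x) :=
      ((integrable_indicator_iff measurableSet_Iic).2 hRi.abs).mul_bdd
        hkc.aestronglyMeasurable (.of_forall hkn)
    refine ((hki.const_mul (2 * C)).add (h1.const_mul 2)).congr (.of_forall fun x => ?_)
    simp only [hb, Pi.add_apply]
    ring
  have hle : ∀ ε : ℝ, 0 < ε → ∀ x, ‖Real.exp (-ε * x) * R x * k x‖ ≤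
      Real.exp (-ε * x) * R x * k x + b x := by
    intro ε hε x
    have hind : 0 ≤ (Iic x₀).indicator (fun x => |R x|) x :=
      indicator_nonneg (fun _ _ => abs_nonneg _) x
    rcases le_or_gt x 0 with hx | hx
    · rw [hR0 x hx]
      simp only [mul_zero, zero_mul, norm_zero, zero_add]
      exact mul_nonneg (by positivity) (hk0 x)
    have he := Real.exp_pos (-ε * x)
    have he1 : Real.exp (-ε * x) ≤ 1 := by
      rw [Real.exp_le_one_iff]
      nlinarith
    have h1 : |R x| ≤ R x + (2 * C + 2 * (Iic x₀).indicator (fun x => |R x|) x) := by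
      rcases le_or_gt x x₀ with h | h
      · rw [indicator_of_mem (show x ∈ Iic x₀ from h)]
        linarith [neg_abs_le (R x)]
      · rcases abs_cases (R x) with h2 | h2 <;> linarith [hlow x h.le]
    rw [norm_mul, norm_mul, Real.norm_of_nonneg he.le, Real.norm_of_nonneg (hk0 x), hb,
      ← add_mul, Real.norm_eq_abs]
    refine mul_le_mul_of_nonneg_right ?_ (hk0 x)
    have h2 := mul_le_mul_of_nonneg_left h1 he.le
    have h3 := mul_le_of_le_one_left
      (show 0 ≤ 2 * C + 2 * (Iic x₀).indicator (fun x => |R x|) x by positivity) he1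
    linarith
  set εs : ℕ → ℝ := fun n => 1 / ((n : ℝ) + 1) with hεs
  have hεpos : ∀ n, 0 < εs n := fun n => Nat.one_div_pos_of_nat
  have hεlim : Tendsto εs atTop (𝓝[>] 0) :=
    tendsto_nhdsWithin_iff.2 ⟨tendsto_one_div_add_atTop_nhds_zero_nat,
      .of_forall fun n => hεpos n⟩
  have hpt : ∀ x, Tendsto (fun ε : ℝ => Real.exp (-ε * x) * R x * k x) (𝓝[>] 0)
      (𝓝 (R x * k x)) := by
    intro x
    have hcont : Continuous fun ε : ℝ => Real.exp (-ε * x) * R x * k x := by fun_prop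
    simpa using (hcont.tendsto 0).mono_left nhdsWithin_le_nhds
  have hint : Integrable (fun x => R x * k x) := by
    refine integrable_of_tendsto (G := fun n x => Real.exp (-εs n * x) * R x * k x)
      (.of_forall fun x => (hpt x).comp hεlim) (fun n => (hd _ (hεpos n)).1) ?_
    refine ne_top_of_le_ne_top (b := ENNReal.ofReal (L + 1 + ∫ x, b x)) ENNReal.ofReal_ne_top ?_
    refine liminf_le_of_frequently_le' (Eventually.frequently ?_)
    filter_upwards [(hlim.comp hεlim).eventually (gt_mem_nhds (lt_add_one L))] with n hn
    rw [← ofReal_integral_norm_eq_lintegral_enorm (hd _ (hεpos n))]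
    refine ENNReal.ofReal_le_ofReal ?_
    refine (integral_mono (hd _ (hεpos n)).norm ((hd _ (hεpos n)).add hbi)
      (hle _ (hεpos n))).trans ?_
    rw [integral_add' (hd _ (hεpos n)) hbi]
    exact add_le_add hn.le le_rfl
  refine ⟨hint, tendsto_nhds_unique ?_ hlim⟩
  refine tendsto_integral_filter_of_dominated_convergence (fun x => ‖R x * k x‖) ?_ ?_ hint.norm
    (.of_forall hpt)
  · filter_upwards [self_mem_nhdsWithin] with ε hε using (hd ε hε).1
  · filter_upwards [self_mem_nhdsWithin] with ε hε
    refine .of_forall fun x => ?_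
    rcases le_or_gt x 0 with hx | hx
    · simp [hR0 x hx]
    · rw [mul_assoc, norm_mul, Real.norm_of_nonneg (Real.exp_pos _).le]
      refine mul_le_of_le_one_left (norm_nonneg _) ?_
      rw [Real.exp_le_one_iff]
      nlinarith [mem_Ioi.1 hε]

/-- The distributional boundary value, tested against modulated kernels, computes the averages of
the remainder; these vanish at infinity because the boundary value is a local pseudofunction. -/
lemma averagesVanish_remainder {S : ℝ → ℝ} (hA : LaplaceAbsConverges S) {a C x₀ : ℝ} (hC : 0 ≤ C)
    (hlow : ∀ x, x₀ ≤ x → -C ≤ remainder S a x)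
    {g : 𝓓((⊤ : TopologicalSpace.Opens ℝ), ℂ) →L[ℂ] ℂ} (hg : IsLocalPseudofunction g)
    (hlim : ∀ φ : 𝓓((⊤ : TopologicalSpace.Opens ℝ), ℂ), Tendsto (fun σ : ℝ => ∫ t : ℝ,
      (laplace S ((σ : ℂ) + Complex.I * t) - a / ((σ : ℂ) + Complex.I * t - 1)) * φ t)
      (𝓝[>] 1) (𝓝 (g φ)))
    {K : ℝ → ℝ} (hK : IsAveragingKernel K) {φ : 𝓓((⊤ : TopologicalSpace.Opens ℝ), ℂ)}
    (hφ : ∀ x, angularFourier φ x = (K x : ℂ)) : AveragesVanish K (remainder S a) := by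
  obtain ⟨B, hB⟩ := hK.exists_bound
  have key : ∀ l : ℝ, 0 < l → ∀ ψ : 𝓓((⊤ : TopologicalSpace.Opens ℝ), ℂ),
      (∀ x, angularFourier ψ x = (K (l * x) : ℂ)) → ∀ h : ℝ,
      Integrable (fun x => remainder S a x * K (l * (x - h))) ∧
        ∫ x, remainder S a x * K (l * (x - h)) = (g (modulate h ψ)).re := by
    intro l hl ψ hψ h
    refine integrable_mul_of_tendsto_damped hC (fun x hx => remainder_of_nonpos hx)
      (fun ε hε => integrable_exp_mul_remainder hA a hε)
      (integrableOn_Iic_remainder hA a x₀) hlow (fun x => hK.nonneg _)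
      (hK.continuous.comp (by fun_prop)) (hK.integrable_dilate hl h) (fun x => hB _) ?_
    have h1 := (Complex.continuous_re.tendsto _).comp (hlim (modulate h ψ))
    have h2 : Tendsto (fun ε : ℝ => 1 + ε) (𝓝[>] 0) (𝓝[>] 1) := by
      refine tendsto_nhdsWithin_iff.2 ⟨?_, ?_⟩
      · have : Continuous fun ε : ℝ => 1 + ε := by fun_prop
        simpa using (this.tendsto 0).mono_left nhdsWithin_le_nhds
      · filter_upwards [self_mem_nhdsWithin] with ε hε
        simpa using hε
    refine (h1.comp h2).congr' ?_
    filter_upwards [self_mem_nhdsWithin] with ε hε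
    have hε' : (1 : ℝ) < 1 + ε := by simpa using hε
    simp only [Function.comp_apply]
    rw [integral_laplace_sub_mul hA a hε' (modulate h ψ), ← Complex.ofReal_re (∫ x, _),
      ← integral_complex_ofReal]
    congr 2 with x
    rw [angularFourier_modulate, hψ, add_sub_cancel_left]
    push_cast
    rfl
  have hdil : ∀ l : ℝ, 0 < l → ∃ ψ : 𝓓((⊤ : TopologicalSpace.Opens ℝ), ℂ),
      ∀ x, angularFourier ψ x = (K (l * x) : ℂ) := fun l hl => by
    obtain ⟨ψ, hψ⟩ := exists_angularFourier_dilate φ hl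
    exact ⟨ψ, fun x => by rw [hψ, hφ]⟩
  refine ⟨fun l hl h => ?_, fun l hl => ?_⟩
  · obtain ⟨ψ, hψ⟩ := hdil l hl
    exact (key l hl ψ hψ h).1
  · obtain ⟨ψ, hψ⟩ := hdil l hl
    simp_rw [fun h => (key l hl ψ hψ h).2]
    exact (Complex.continuous_re.tendsto 0).comp (hg.tendsto_modulate ψ)

theorem tendsto_div_exp_of_boundary {S : ℝ → ℝ}
    (hS : LocallyIntegrableOn S (Ici (0 : ℝ)) volume) {a : ℝ} (hD : LogLinearlySlowlyDecreasing S)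
    (hL : ∀ s : ℂ, 1 < s.re → LaplaceConverges S s)
    (hG : HasLocalPseudofunctionBoundary (fun s : ℂ => laplace S s - (a : ℂ) / (s - 1)) 1 ⊤) :
    Tendsto (fun x : ℝ => S x / Real.exp x) atTop (𝓝 a) := by
  obtain ⟨C, x₀, hC0, hx₀, hC⟩ := hD.exists_lower_bound
  have hA : LaplaceAbsConverges S := fun σ hσ =>
    integrableOn_exp_mul_of_laplaceConverges hS hx₀ hC hσ (hL σ (by simpa using hσ))
  obtain ⟨-, g, hg, hlim⟩ := hG
  obtain ⟨K, hK, φ, hφ⟩ := exists_averagingKernel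
  have hlow : ∀ x, x₀ ≤ x → -(C + |a|) ≤ remainder S a x := by
    intro x hx
    rcases le_or_gt x 0 with h | h
    · rw [remainder_of_nonpos h]
      linarith [abs_nonneg a]
    · rw [remainder_of_pos h]
      linarith [hC x hx, le_abs_self a]
  have hF := averagesVanish_remainder hA (by positivity) hlow hg hlim hK hφ
  have hzero := hK.tendsto_zero_of_averagesVanish hF (integrableOn_Iic_remainder hA a)
    (a := a) (by positivity) hlow (fun ε hε => by
      obtain ⟨δ, hδ, x₁, H⟩ := hD.exp_neg_mul_le hε
      refine ⟨δ, hδ, max x₁ 1, fun x hx h h0 h1 => ?_⟩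
      have hx1 := (le_max_right x₁ 1).trans hx
      rw [remainder_of_pos (by linarith), remainder_of_pos (by linarith), sub_add_cancel,
        sub_add_cancel]
      exact H x ((le_max_left _ _).trans hx) h h0 h1)
  have := hzero.add_const a
  rw [zero_add] at this
  refine this.congr' ?_
  filter_upwards [eventually_gt_atTop 0] with x hx
  rw [remainder_of_pos hx, sub_add_cancel]

/-! ### The asymptotics imply the boundary behaviour -/

lemma continuous_testToSchwartz_comp {U : TopologicalSpace.Opens ℝ}
    {K : TopologicalSpace.Compacts ℝ} (hK : (K : Set ℝ) ⊆ U) :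
    Continuous ((testToSchwartz : 𝓓(U, ℂ) → 𝓢(ℝ, ℂ)) ∘ TestFunction.ofSupportedIn hK) := by
  let Φ : ContDiffMapSupportedIn ℝ ℂ ⊤ K →ₗ[ℝ] 𝓢(ℝ, ℂ) :=
    { toFun := (testToSchwartz : 𝓓(U, ℂ) → 𝓢(ℝ, ℂ)) ∘ TestFunction.ofSupportedIn hK
      map_add' := fun _ _ => rfl
      map_smul' := fun _ _ => rfl }
  obtain ⟨r, hr⟩ := K.isCompact.isBounded.exists_norm_le
  change Continuous Φ
  refine WithSeminorms.continuous_of_isBounded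
    (ContDiffMapSupportedIn.withSeminorms ℝ ℝ ℂ ⊤ K) (schwartz_withSeminorms ℝ ℝ ℂ) Φ fun kn => ?_
  refine ⟨{kn.2}, ⟨|r| ^ kn.1, by positivity⟩, fun f => ?_⟩
  rw [Finset.sup_singleton]
  refine SchwartzMap.seminorm_le_bound ℝ kn.1 kn.2 (Φ f) (by positivity) fun x => ?_
  change ‖x‖ ^ kn.1 * ‖iteratedFDeriv ℝ kn.2 f x‖ ≤
    |r| ^ kn.1 * ContDiffMapSupportedIn.seminorm ℝ ℝ ℂ ⊤ K kn.2 f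
  by_cases hx : x ∈ K
  · have h1 : ‖x‖ ≤ |r| := (hr x hx).trans (le_abs_self r)
    gcongr
    exact ContDiffMapSupportedIn.norm_iteratedFDeriv_apply_le_seminorm_top ℝ
  · rw [ContDiffMapSupportedIn.iteratedFDeriv_zero_on_compl f hx]
    simp only [Pi.zero_apply, norm_zero, mul_zero]
    positivity

/-- The restriction of a tempered distribution to test functions. -/
noncomputable def restrictToTest (U : TopologicalSpace.Opens ℝ) (T : 𝓢'(ℝ, ℂ)) :
    𝓓(U, ℂ) →L[ℂ] ℂ :=
  TestFunction.mkCLM ℂ (fun φ => T (testToSchwartz φ))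
    (fun f g => map_add T (testToSchwartz f) (testToSchwartz g))
    (fun c f => map_smul T c (testToSchwartz f))
    (fun _ hK => (map_continuous T).comp (continuous_testToSchwartz_comp hK))

/-- The Fourier transform of an integrable function with bounded support plus a bounded function
vanishing at infinity is a local pseudofunction. The first part transforms to a smooth function,
which becomes a pseudofunction after multiplication by a cutoff; the second is one globally. -/
lemma exists_localPseudofunction {ρ₁ ρ₂ : ℝ → ℂ} (h₁ : Integrable ρ₁)
    (h₁s : HasCompactSupport ρ₁) (h₂m : AEStronglyMeasurable ρ₂ volume) {M : ℝ}
    (h₂b : ∀ y, ‖ρ₂ y‖ ≤ M) (h₂0 : Tendsto ρ₂ (cocompact ℝ) (𝓝 0))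
    (U : TopologicalSpace.Opens ℝ) :
    ∃ g : 𝓓(U, ℂ) →L[ℂ] ℂ, IsLocalPseudofunction g ∧
      ∀ φ : 𝓓(U, ℂ), g φ = ∫ y, (ρ₁ y + ρ₂ y) * 𝓕 (φ : ℝ → ℂ) y := by
  have h₂p : MemLp ρ₂ ⊤ volume := memLp_top_of_bound h₂m M (.of_forall h₂b)
  have h₁p : MemLp ρ₁ 1 volume := memLp_one_iff_integrable.2 h₁
  let T₁ : 𝓢'(ℝ, ℂ) := Lp.toTemperedDistribution (h₁p.toLp ρ₁)
  let T₂ : 𝓢'(ℝ, ℂ) := Lp.toTemperedDistribution (h₂p.toLp ρ₂)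
  have hT₁ : ∀ φ : 𝓢(ℝ, ℂ), T₁ φ = ∫ y, φ y * ρ₁ y := fun φ => by
    rw [Lp.toTemperedDistribution_apply]
    exact integral_congr_ae (h₁p.coeFn_toLp.mono fun y hy => by simp only [hy, smul_eq_mul])
  have hT₂ : ∀ φ : 𝓢(ℝ, ℂ), T₂ φ = ∫ y, φ y * ρ₂ y := fun φ => by
    rw [Lp.toTemperedDistribution_apply]
    exact integral_congr_ae (h₂p.coeFn_toLp.mono fun y hy => by simp only [hy, smul_eq_mul])
  have hval : ∀ φ : 𝓓(U, ℂ), restrictToTest U (𝓕 T₁ + 𝓕 T₂) φ =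
      (∫ y, (𝓕 (testToSchwartz φ)) y * ρ₁ y) + ∫ y, (𝓕 (testToSchwartz φ)) y * ρ₂ y :=
    fun φ => by
      rw [← hT₁, ← hT₂]
      rfl
  refine ⟨restrictToTest U (𝓕 T₁ + 𝓕 T₂), fun t₀ ht₀ => ?_, fun φ => ?_⟩
  · -- The Fourier transform of `ρ₁` is smooth since all moments of `ρ₁` are finite.
    have hsmooth : ContDiff ℝ (⊤ : ℕ∞) (𝓕 ρ₁) := by
      refine Real.contDiff_fourier fun n _ => ?_
      obtain ⟨r, hr⟩ := h₁s.isCompact.isBounded.exists_norm_le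
      refine (h₁.norm.const_mul (|r| ^ n)).mono'
        (((continuous_norm.pow n).aestronglyMeasurable).mul h₁.1.norm) (.of_forall fun v => ?_)
      rw [norm_mul, norm_pow, norm_norm, norm_norm]
      by_cases hv : v ∈ tsupport ρ₁
      · exact mul_le_mul_of_nonneg_right
          (pow_le_pow_left₀ (norm_nonneg _) ((hr v hv).trans (le_abs_self r)) n) (norm_nonneg _)
      · simp [image_eq_zero_of_notMem_tsupport hv]
    let χ : ContDiffBump t₀ := default
    have hχs : HasCompactSupport fun t => (χ t : ℂ) * 𝓕 ρ₁ t :=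
      (χ.hasCompactSupport.comp_left (g := Complex.ofReal) rfl).mul_right
    have hχd : ContDiff ℝ (⊤ : ℕ∞) fun t => (χ t : ℂ) * 𝓕 ρ₁ t :=
      (Complex.ofRealCLM.contDiff.comp χ.contDiff).mul hsmooth
    let ψ : 𝓢(ℝ, ℂ) := hχs.toSchwartzMap hχd
    refine ⟨Metric.ball t₀ χ.rIn ∩ U, Metric.isOpen_ball.inter U.isOpen,
      ⟨Metric.mem_ball_self χ.rIn_pos, ht₀⟩, inter_subset_right,
      SchwartzMap.toTemperedDistributionCLM ℝ ℂ volume ψ + 𝓕 T₂, ?_, fun φ hφ => ?_⟩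
    · refine ⟨fun y => (𝓕 ψ) y + ρ₂ (-y), ?_, ?_, fun φ => ?_⟩
      · exact ((𝓕 ψ).memLp ⊤ volume).add
          (h₂p.comp_measurePreserving (Measure.measurePreserving_neg (volume : Measure ℝ)))
      · have h3 : Tendsto (fun y => (𝓕 ψ) y) (cocompact ℝ) (𝓝 0) :=
          (𝓕 ψ).toZeroAtInfty.zero_at_infty'
        have h4 : Tendsto (fun y : ℝ => -y) (cocompact ℝ) (cocompact ℝ) :=
          (Homeomorph.neg ℝ).isClosedEmbedding.tendsto_cocompact
        simpa using h3.add (h₂0.comp h4)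
      · have e1 : (𝓕 (SchwartzMap.toTemperedDistributionCLM ℝ ℂ volume ψ + 𝓕 T₂)) φ =
            (∫ y, (𝓕 φ) y * ψ y) + T₂ (𝓕 (𝓕 φ)) := by
          rw [TemperedDistribution.fourier_apply]
          change SchwartzMap.toTemperedDistributionCLM ℝ ℂ volume ψ (𝓕 φ) + T₂ (𝓕 (𝓕 φ)) = _
          rw [SchwartzMap.toTemperedDistributionCLM_apply_apply volume ψ]
          rfl
        have e2 : ∀ y, (𝓕 (𝓕 φ)) y = φ (-y) := fun y => by
          have : (𝓕⁻ (𝓕 φ)) (-y) = φ (-y) := by rw [FourierTransform.fourierInv_fourier_eq]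
          rw [← this, SchwartzMap.fourierInv_coe, Real.fourierInv_eq_fourier_neg, neg_neg]
          rfl
        have e3 : Integrable fun y => φ y * (𝓕 ψ) y :=
          (𝓕 ψ).integrable.bdd_mul (c := SchwartzMap.seminorm ℝ 0 0 φ)
            φ.continuous.aestronglyMeasurable
            (.of_forall fun y => SchwartzMap.norm_le_seminorm ℝ φ y)
        have e4 : Integrable fun y => φ y * ρ₂ (-y) :=
          φ.integrable.mul_bdd (c := M)
            (h₂m.comp_measurePreserving (Measure.measurePreserving_neg (volume : Measure ℝ)))
            (.of_forall fun y => h₂b _)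
        rw [e1, hT₂, SchwartzMap.integral_fourier_mul_eq]
        simp_rw [e2, mul_add]
        rw [integral_add e3 e4, ← integral_neg_eq_self (fun y => φ (-y) * ρ₂ y)]
        simp
    · have e1 : (SchwartzMap.toTemperedDistributionCLM ℝ ℂ volume ψ + 𝓕 T₂)
          (testToSchwartz φ) = (∫ y, φ y * ψ y) + T₂ (𝓕 (testToSchwartz φ)) := by
        change SchwartzMap.toTemperedDistributionCLM ℝ ℂ volume ψ (testToSchwartz φ) +
          T₂ (𝓕 (testToSchwartz φ)) = _
        rw [SchwartzMap.toTemperedDistributionCLM_apply_apply volume ψ]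
        rfl
      rw [hval, e1, hT₂]
      congr 1
      have e2 : ∫ y, (𝓕 (φ : ℝ → ℂ)) y * ρ₁ y = ∫ y, φ y * (𝓕 ρ₁) y := by
        simpa using! VectorFourier.integral_fourierIntegral_smul_eq_flip (L := innerₗ ℝ)
          Real.continuous_fourierChar continuous_inner
          (φ.continuous.integrable_of_hasCompactSupport φ.hasCompactSupport) h₁
      refine e2.trans (integral_congr_ae (.of_forall fun y => ?_))
      change φ y * 𝓕 ρ₁ y = φ y * ((χ y : ℂ) * 𝓕 ρ₁ y)
      by_cases hy : y ∈ tsupport (φ : ℝ → ℂ)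
      · rw [χ.one_of_mem_closedBall (Metric.ball_subset_closedBall (hφ hy).1)]
        simp
      · simp [image_eq_zero_of_notMem_tsupport hy]
  · obtain ⟨b, hb⟩ : ∃ b, ∀ y, ‖(𝓕 (testToSchwartz φ)) y‖ ≤ b :=
      ⟨_, fun y => SchwartzMap.norm_le_seminorm ℝ _ y⟩
    have e1 : Integrable fun y => (𝓕 (testToSchwartz φ)) y * ρ₁ y :=
      h₁.bdd_mul (SchwartzMap.continuous _).aestronglyMeasurable (.of_forall hb)
    have e2 : Integrable fun y => (𝓕 (testToSchwartz φ)) y * ρ₂ y :=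
      (SchwartzMap.integrable _).mul_bdd h₂m (.of_forall h₂b)
    rw [hval, ← integral_add e1 e2]
    congr 1 with y
    rw [← mul_add, mul_comm]
    rfl

lemma differentiableOn_laplace_sub {S : ℝ → ℝ} (hA : LaplaceAbsConverges S) (a : ℝ) :
    DifferentiableOn ℂ (fun s : ℂ => laplace S s - (a : ℂ) / (s - 1)) {s : ℂ | 1 < s.re} := by
  intro s hs
  have hopen : IsOpen {s : ℂ | 1 < s.re} := isOpen_lt continuous_const Complex.continuous_re
  have hs1 : 1 < s.re := hs
  set ε := (s.re - 1) / 2 with hε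
  have hε0 : 0 < ε := by rw [hε]; linarith
  have hm := aestronglyMeasurable_remainder hA a
  have hmc : AEStronglyMeasurable (fun x => (remainder S a x : ℂ)) volume :=
    Complex.continuous_ofReal.comp_aestronglyMeasurable hm
  have hexp : ∀ z : ℂ, AEStronglyMeasurable (fun x : ℝ => Complex.exp (-(z - 1) * x)) volume :=
    fun z => Continuous.aestronglyMeasurable (by fun_prop)
  have hnorm : ∀ (z : ℂ) (x : ℝ), ‖Complex.exp (-(z - 1) * x)‖ = Real.exp (-(z.re - 1) * x) := by
    intro z x
    rw [Complex.norm_exp]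
    simp
  have key := hasDerivAt_integral_of_dominated_loc_of_deriv_le (μ := (volume : Measure ℝ))
    (F := fun (z : ℂ) (x : ℝ) => Complex.exp (-(z - 1) * x) * (remainder S a x : ℂ))
    (F' := fun (z : ℂ) (x : ℝ) =>
      Complex.exp (-(z - 1) * x) * (-1 * x) * (remainder S a x : ℂ))
    (bound := fun x => 2 / ε * ‖Real.exp (-(ε / 2) * x) * remainder S a x‖)
    (x₀ := s) (Metric.ball_mem_nhds s hε0) (.of_forall fun z => (hexp z).mul hmc) ?_ ?_ ?_ ?_ ?_
  · refine (key.2.differentiableAt.congr_of_eventuallyEq ?_).differentiableWithinAt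
    filter_upwards [hopen.mem_nhds hs] with z hz using laplace_sub_eq_integral hA a hz
  · refine (integrable_exp_mul_remainder hA a (sub_pos.2 hs1)).norm.mono' ((hexp s).mul hmc)
      (.of_forall fun x => ?_)
    rw [norm_mul, hnorm, norm_mul, Real.norm_of_nonneg (Real.exp_pos _).le, Complex.norm_real]
  · exact ((hexp s).mul (Continuous.aestronglyMeasurable (by fun_prop))).mul hmc
  · refine .of_forall fun x z hz => ?_
    rcases le_or_gt x 0 with hx | hx
    · simp [remainder_of_nonpos hx]
    have hzre : ε ≤ z.re - 1 := by
      have h1 := (Complex.abs_re_le_norm (z - s)).trans_lt (mem_ball_iff_norm.1 hz)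
      rw [Complex.sub_re] at h1
      linarith [(abs_lt.1 h1).1]
    -- `x ≤ (2 / ε) e^{ε x / 2}` absorbs the factor produced by differentiation.
    have h1 : x ≤ 2 / ε * Real.exp (ε / 2 * x) := by
      have h2 : ε / 2 * x ≤ Real.exp (ε / 2 * x) :=
        (le_add_of_nonneg_right zero_le_one).trans (Real.add_one_le_exp _)
      have h3 := mul_le_mul_of_nonneg_left h2 (show 0 ≤ 2 / ε by positivity)
      rwa [← mul_assoc, div_mul_div_cancel₀ hε0.ne', div_self two_ne_zero, one_mul] at h3
    have h4 : Real.exp (-(z.re - 1) * x) ≤ Real.exp (-ε * x) :=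
      Real.exp_le_exp.2 (by nlinarith)
    have h5 : Real.exp (-ε * x) * Real.exp (ε / 2 * x) = Real.exp (-(ε / 2) * x) := by
      rw [← Real.exp_add]
      congr 1
      ring
    rw [norm_mul, norm_mul, hnorm, norm_mul, norm_neg, norm_one, one_mul, Complex.norm_real,
      Complex.norm_real, norm_mul, Real.norm_of_nonneg hx.le,
      Real.norm_of_nonneg (Real.exp_pos (-(ε / 2) * x)).le, ← mul_assoc]
    refine mul_le_mul_of_nonneg_right ?_ (norm_nonneg _)
    calc Real.exp (-(z.re - 1) * x) * x
        ≤ Real.exp (-ε * x) * (2 / ε * Real.exp (ε / 2 * x)) :=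
          mul_le_mul h4 h1 hx.le (Real.exp_pos _).le
      _ = 2 / ε * Real.exp (-(ε / 2) * x) := by rw [mul_left_comm, h5]
  · exact (integrable_exp_mul_remainder hA a (half_pos hε0)).norm.const_mul _
  · refine .of_forall fun x z _ => ?_
    refine HasDerivAt.mul_const ?_ _
    have h1 : HasDerivAt (fun z : ℂ => -(z - 1) * x) (-1 * x) z :=
      (((hasDerivAt_id z).sub_const 1).neg).mul_const _
    exact h1.cexp

lemma logLinearlySlowlyDecreasing_of_tendsto {S : ℝ → ℝ} {a : ℝ}
    (h : Tendsto (fun x : ℝ => S x / Real.exp x) atTop (𝓝 a)) :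
    LogLinearlySlowlyDecreasing S := by
  intro ε hε
  have hcont : Continuous fun t : ℝ => Real.exp t * (a - ε / 8) - (a + ε / 8) := by fun_prop
  -- At `t = 0` the lower bound `e^t (a - ε/8) - (a + ε/8)` equals `-ε/4`.
  have h0 : -ε < Real.exp 0 * (a - ε / 8) - (a + ε / 8) := by
    rw [Real.exp_zero]
    linarith
  obtain ⟨r, hr, H⟩ := Metric.eventually_nhds_iff.1
    ((hcont.tendsto 0).eventually (lt_mem_nhds h0))
  obtain ⟨X, hX⟩ := Metric.tendsto_atTop.1 h (ε / 8) (by positivity)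
  refine ⟨r / 2, by positivity, X, fun x hx t ht0 ht1 => ?_⟩
  have h1 := H (y := t) (by rw [Real.dist_eq, sub_zero, abs_of_nonneg ht0]; linarith)
  have h2 := abs_lt.1 (hX x hx)
  have h3 := abs_lt.1 (hX (x + t) (by linarith))
  have h4 : S (x + t) / Real.exp x = Real.exp t * (S (x + t) / Real.exp (x + t)) := by
    rw [Real.exp_add]
    field_simp
  have h5 := mul_le_mul_of_nonneg_left
    (show a - ε / 8 ≤ S (x + t) / Real.exp (x + t) by linarith) (Real.exp_pos t).le
  rw [sub_div, h4]
  linarith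

lemma laplaceAbsConverges_of_tendsto {S : ℝ → ℝ}
    (hS : LocallyIntegrableOn S (Ici (0 : ℝ)) volume) {a : ℝ}
    (h : Tendsto (fun x : ℝ => S x / Real.exp x) atTop (𝓝 a)) : LaplaceAbsConverges S := by
  intro σ hσ
  obtain ⟨X, hX⟩ := Metric.tendsto_atTop.1 h 1 one_pos
  set X₀ := max X 0 with hX₀
  rw [← Ioc_union_Ioi_eq_Ioi (show 0 ≤ X₀ from le_max_right _ _)]
  refine (integrableOn_Ioc_exp_mul hS σ X₀).union ?_
  have hmeas : AEStronglyMeasurable S (volume.restrict (Ioi X₀)) :=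
    hS.aestronglyMeasurable.mono_set fun x hx => (le_max_right X 0).trans (le_of_lt hx)
  refine ((exp_neg_integrableOn_Ioi X₀ (sub_pos.2 hσ)).const_mul (|a| + 1)).mono'
    ((Continuous.aestronglyMeasurable (by fun_prop)).mul hmeas) ?_
  filter_upwards [ae_restrict_mem measurableSet_Ioi] with x hx
  have h1 := abs_lt.1 (hX x ((le_max_left X 0).trans (le_of_lt hx)))
  have h2 : |S x / Real.exp x| ≤ |a| + 1 :=
    abs_le.2 ⟨by linarith [neg_abs_le a], by linarith [le_abs_self a]⟩
  have h3 : Real.exp (-σ * x) * S x = (S x / Real.exp x) * Real.exp (-(σ - 1) * x) := by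
    rw [show -(σ - 1) * x = -σ * x + x by ring, Real.exp_add]
    field_simp
  rw [h3, norm_mul, Real.norm_of_nonneg (Real.exp_pos _).le]
  exact mul_le_mul_of_nonneg_right h2 (Real.exp_pos _).le

lemma tendsto_remainder {S : ℝ → ℝ} {a : ℝ}
    (h : Tendsto (fun x : ℝ => S x / Real.exp x) atTop (𝓝 a)) :
    Tendsto (remainder S a) atTop (𝓝 0) := by
  have := h.sub_const a
  rw [sub_self] at this
  refine this.congr' ?_
  filter_upwards [eventually_gt_atTop 0] with x hx using (remainder_of_pos hx).symm

/-- The remainder, with its variable rescaled to Mathlib's normalisation of the Fourier transform,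
splits as an integrable part on a bounded interval plus a bounded part vanishing at infinity. -/
lemma hasLocalPseudofunctionBoundary_of_tendsto {S : ℝ → ℝ} (hA : LaplaceAbsConverges S) {a : ℝ}
    (h : Tendsto (fun x : ℝ => S x / Real.exp x) atTop (𝓝 a))
    (U : TopologicalSpace.Opens ℝ) :
    HasLocalPseudofunctionBoundary (fun s : ℂ => laplace S s - (a : ℂ) / (s - 1)) 1 U := by
  have hR0 := tendsto_remainder h
  have hRm := aestronglyMeasurable_remainder hA a
  set R := remainder S a with hR
  obtain ⟨X, hX⟩ := Metric.tendsto_atTop.1 hR0 1 one_pos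
  have hRb : ∀ x, X ≤ x → ‖R x‖ ≤ 1 := fun x hx => by
    have := hX x hx
    rw [dist_zero_right] at this
    exact this.le
  set R₁ : ℝ → ℂ := (Iic X).indicator fun x => (R x : ℂ) with hR₁
  set R₂ : ℝ → ℂ := (Ioi X).indicator fun x => (R x : ℂ) with hR₂
  have hR₁i : Integrable R₁ := (integrable_indicator_iff measurableSet_Iic).2
    (integrableOn_Iic_remainder hA a X).ofReal
  have hR₂m : AEStronglyMeasurable R₂ volume :=
    (Complex.continuous_ofReal.comp_aestronglyMeasurable hRm).indicator measurableSet_Ioi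
  have hR₂b : ∀ x, ‖R₂ x‖ ≤ 1 := fun x => by
    by_cases hx : x ∈ Ioi X
    · rw [hR₂, indicator_of_mem hx, Complex.norm_real]
      exact hRb x (le_of_lt hx)
    · rw [hR₂, indicator_of_notMem hx, norm_zero]
      exact zero_le_one
  have hR₂0 : Tendsto R₂ (cocompact ℝ) (𝓝 0) := by
    rw [cocompact_eq_atBot_atTop, tendsto_sup]
    constructor
    · refine tendsto_const_nhds.congr' ?_
      filter_upwards [eventually_le_atBot X] with x hx
      rw [hR₂, indicator_of_notMem (by simpa using hx)]
    · have : Tendsto (fun x => (R x : ℂ)) atTop (𝓝 0) := by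
        simpa [Function.comp_def] using (Complex.continuous_ofReal.tendsto 0).comp hR0
      refine this.congr' ?_
      filter_upwards [eventually_gt_atTop X] with x hx
      rw [hR₂, indicator_of_mem (show x ∈ Ioi X from hx)]
  have hR₁s : HasCompactSupport R₁ := by
    refine HasCompactSupport.of_support_subset_isCompact (isCompact_Icc (a := (0 : ℝ)) (b := X)) ?_
    intro x hx
    rw [Function.mem_support] at hx
    by_contra hx'
    apply hx
    by_cases h1 : x ∈ Iic X
    · have : x ≤ 0 := by
        by_contra h2
        exact hx' ⟨(not_le.1 h2).le, h1⟩
      simp [hR₁, hR, remainder_of_nonpos this]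
    · exact indicator_of_notMem h1 _
  have hsplit : ∀ x, R₁ x + R₂ x = (R x : ℂ) := fun x => by
    by_cases hx : x ≤ X
    · rw [hR₁, hR₂, indicator_of_mem (show x ∈ Iic X from hx),
        indicator_of_notMem (by simpa using hx), add_zero]
    · rw [hR₁, hR₂, indicator_of_notMem (show x ∉ Iic X from hx),
        indicator_of_mem (by simpa using hx), zero_add]
  have hc : 2 * Real.pi ≠ 0 := by positivity
  have hρ₂0 := (hR₂0.comp
    (Homeomorph.mulLeft₀ _ hc).isClosedEmbedding.tendsto_cocompact).const_mul
      ((2 * Real.pi : ℝ) : ℂ)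
  rw [mul_zero] at hρ₂0
  obtain ⟨g, hg, hgv⟩ := exists_localPseudofunction
    (ρ₁ := fun y => ((2 * Real.pi : ℝ) : ℂ) * R₁ (2 * Real.pi * y))
    (ρ₂ := fun y => ((2 * Real.pi : ℝ) : ℂ) * R₂ (2 * Real.pi * y)) (M := 2 * Real.pi * 1)
    ((hR₁i.comp_mul_left' hc).const_mul _)
    ((hR₁s.comp_homeomorph (Homeomorph.mulLeft₀ _ hc)).mul_left)
    ((hR₂m.comp_quasiMeasurePreserving
      (Measure.quasiMeasurePreserving_smul volume hc)).const_mul _)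
    (fun y => by
      rw [norm_mul, Complex.norm_real, Real.norm_of_nonneg (by positivity)]
      exact mul_le_mul_of_nonneg_left (hR₂b _) (by positivity))
    hρ₂0 U
  refine ⟨differentiableOn_laplace_sub hA a, g, hg, fun φ => ?_⟩
  have hgφ : g φ = ∫ x, (R x : ℂ) * angularFourier φ x := by
    have h1 := Measure.integral_comp_mul_left
      (fun x => (R x : ℂ) * angularFourier φ x) (2 * Real.pi)
    rw [hgv, ← smul_inv_smul₀ hc (∫ x, (R x : ℂ) * angularFourier φ x),
      ← abs_of_pos (show 0 < (2 * Real.pi)⁻¹ by positivity), ← h1, Complex.real_smul,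
      ← integral_const_mul]
    congr 1 with y
    rw [← mul_add, hsplit, angularFourier_eq_fourier, mul_div_cancel_left₀ y hc, mul_assoc]
  have hint : Integrable fun x => (R x : ℂ) * angularFourier φ x := by
    obtain ⟨B, hB⟩ := exists_bound_angularFourier φ
    have i1 : Integrable fun x => R₁ x * angularFourier φ x :=
      hR₁i.mul_bdd (continuous_angularFourier φ).aestronglyMeasurable (.of_forall hB)
    have i2 : Integrable fun x => R₂ x * angularFourier φ x :=
      (integrable_angularFourier φ).bdd_mul hR₂m (.of_forall hR₂b)
    refine (i1.add i2).congr (.of_forall fun x => ?_)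
    simp only [Pi.add_apply]
    rw [← add_mul, hsplit]
  rw [hgφ]
  have hlim : Tendsto (fun σ : ℝ => ∫ x : ℝ,
      ((Real.exp (-(σ - 1) * x) * R x : ℝ) : ℂ) * angularFourier φ x) (𝓝[>] 1)
      (𝓝 (∫ x, (R x : ℂ) * angularFourier φ x)) := by
    refine tendsto_integral_filter_of_dominated_convergence
      (fun x => ‖(R x : ℂ) * angularFourier φ x‖) ?_ ?_ hint.norm (.of_forall fun x => ?_)
    · refine .of_forall fun σ => ?_
      refine (Complex.continuous_ofReal.comp_aestronglyMeasurable
        ((Continuous.aestronglyMeasurable (by fun_prop)).mul hRm)).mul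
        (continuous_angularFourier φ).aestronglyMeasurable
    · filter_upwards [self_mem_nhdsWithin] with σ hσ
      refine .of_forall fun x => ?_
      rcases le_or_gt x 0 with hx | hx
      · simp [hR, remainder_of_nonpos hx]
      · rw [Complex.ofReal_mul, mul_assoc, norm_mul, Complex.norm_real,
          Real.norm_of_nonneg (Real.exp_pos _).le]
        refine mul_le_of_le_one_left (norm_nonneg _) ?_
        rw [Real.exp_le_one_iff]
        nlinarith [mem_Ioi.1 hσ]
    · have hcont : Continuous fun σ : ℝ =>
          ((Real.exp (-(σ - 1) * x) * R x : ℝ) : ℂ) * angularFourier φ x := by fun_prop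
      simpa using (hcont.tendsto 1).mono_left nhdsWithin_le_nhds
  refine hlim.congr' ?_
  filter_upwards [self_mem_nhdsWithin] with σ hσ
  exact (integral_laplace_sub_mul hA a hσ φ).symm

end WienerIkehara

theorem mainTheorem2 (S : ℝ → ℝ) (hS : LocallyIntegrableOn S (Set.Ici (0 : ℝ)) volume) (a : ℝ) :
    Tendsto (fun x : ℝ => S x / Real.exp x) atTop (𝓝 a) ↔
      WienerIkehara.LogLinearlySlowlyDecreasing S ∧
      (∀ s : ℂ, 1 < s.re → WienerIkehara.LaplaceConverges S s) ∧
      WienerIkehara.HasLocalPseudofunctionBoundary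
        (fun s : ℂ => WienerIkehara.laplace S s - (a : ℂ) / (s - 1)) 1 ⊤ := by
  constructor
  · intro h
    have hA := WienerIkehara.laplaceAbsConverges_of_tendsto hS h
    exact ⟨WienerIkehara.logLinearlySlowlyDecreasing_of_tendsto h,
      fun s hs => ⟨_, WienerIkehara.tendsto_laplacePartial hA hs⟩,
      WienerIkehara.hasLocalPseudofunctionBoundary_of_tendsto hA h ⊤⟩
  · rintro ⟨hD, hL, hG⟩
    exact WienerIkehara.tendsto_div_exp_of_boundary hS hD hL hG
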